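/- **Theorem.** Let $F$ be a field of characteristic zero, let $k\ge 2$, and let $L=\mathfrak{sl}_k(F)$ act on $M_k(F)$ by the inner derivations $x\mapsto [c,x]$, $c\in L$. Let $\phi:U(L)\to \operatorname{End}_F(M_k(F))$ be the induced representation of the universal enveloping algebra, and let $U=\phi(U(L))$. Let $F\langle X|U\rangle$ be the free algebra with $U$-exponents, i.e. the nonunital associative $F$-algebra freely generated by symbols $x_i^u$ ($x_i\in X=\{x_1,x_2,\dots\}$, $u\in U$) subject only to $F$-linearity in $u$; its elements are called $U$-polynomials. The algebra $U(L)$ acts on it so that each $\delta\in L$ acts as the derivation with $x_i^u\mapsto x_i^{\phi(\delta)\circ u}$. A $T_U$-ideal is a two-sided ideal of $F\langle X|U\rangle$ which is invariant under this action of $U(L)$ and under all algebra endomorphisms of $F\langle X|U\rangle$ that commute with it; the $T_U$-ideal generated by a set is the smallest $T_U$-ideal containing it. A $U$-polynomial is a $U$-identity of $M_k(F)$ if it vanishes under every evaluation $x_i^u\mapsto u(a_i)$ with $a_1,a_2,\dots\in M_k(F)$. Let $e_{ij}$ be the matrix units, $g=I_k$ and $h_l=e_{ll}-e_{l+1,l+1}$.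 For $a,b$ in the basis $\mathcal M=\{e_{ij}: i\ne j\}\cup\{h_1,\dots,h_{k-1}\}\cup\{g\}$ of $M_k(F)$ let $\varphi_{ab}$ be the endomorphism of $M_k(F)$ that maps $a$ to $b$ and the other elements of $\mathcal M$ to $0$, and write $x^{ab}$ for $x^{\varphi_{ab}}$. (The $\varphi_{ab}$ used below belong to $U$.) Then, with $x,y$ two distinct variables of $X$, the $U$-identities of $M_k(F)$ form the $T_U$-ideal generated by the following four $U$-polynomials: 1. $x^{e_{12}e_{12}}y^{e_{12}e_{12}}$ if $k=2$, respectively $x^{e_{12}e_{12}}y^{e_{12}e_{31}}$ if $k\ge 3$; 2. $x^{e_{12}e_{12}}y^{e_{12}e_{21}}-y^{e_{12}e_{12}}x^{e_{12}e_{21}}$; 3. $[x^{gg},y^{gg}]=x^{gg}y^{gg}-y^{gg}x^{gg}$; 4. $[x^{gg},y^{e_{12}e_{12}}]=x^{gg}y^{e_{12}e_{12}}-y^{e_{12}e_{12}}x^{gg}$. -/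

import Mathlib

namespace DiffMat

attribute [local instance 100] LieRing.ofAssociativeRing

/-! ### Extending a linear endomorphism of `V` to a derivation of the tensor algebra `T(V)` -/

section Derivations

variable {F V : Type*} [Field F] [AddCommGroup V] [Module F V]

/-- The algebra homomorphism `T(V) → T(V)[ε]`, `v ↦ v + ε • d v` (with `ε ^ 2 = 0`). -/
noncomputable def dualLift (d : Module.End F V) :
    TensorAlgebra F V →ₐ[F] TrivSqZeroExt (TensorAlgebra F V) (TensorAlgebra F V) :=
  TensorAlgebra.lift F
    ((TrivSqZeroExt.inlAlgHom F (TensorAlgebra F V) (TensorAlgebra F V)).toLinearMap ∘ₗ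
        TensorAlgebra.ι F
      + (TrivSqZeroExt.inrHom (TensorAlgebra F V) (TensorAlgebra F V)).restrictScalars F ∘ₗ
        TensorAlgebra.ι F ∘ₗ d)

theorem dualLift_fst (d : Module.End F V) (t : TensorAlgebra F V) : (dualLift d t).fst = t := by
  have : (TrivSqZeroExt.fstHom F (TensorAlgebra F V) (TensorAlgebra F V)).comp (dualLift d)
      = AlgHom.id F _ := by
    apply TensorAlgebra.hom_ext
    ext v
    simp [dualLift]
  exact DFunLike.congr_fun this t

/-- The unique derivation of `T(V)` that restricts to `d` on `V`. -/
noncomputable def derExt (d : Module.End F V) : Module.End F (TensorAlgebra F V) :=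
  (TrivSqZeroExt.sndHom (TensorAlgebra F V) (TensorAlgebra F V)).restrictScalars F ∘ₗ
    (dualLift d).toLinearMap

theorem derExt_ι (d : Module.End F V) (v : V) :
    derExt d (TensorAlgebra.ι F v) = TensorAlgebra.ι F (d v) := by
  simp [derExt, dualLift]

theorem derExt_mul (d : Module.End F V) (s t : TensorAlgebra F V) :
    derExt d (s * t) = derExt d s * t + s * derExt d t := by
  simp [derExt, dualLift_fst, add_comm]

theorem derExt_algebraMap (d : Module.End F V) (r : F) :
    derExt d (algebraMap F (TensorAlgebra F V) r) = 0 := by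
  simp [derExt, TrivSqZeroExt.algebraMap_eq_inl']

theorem derivation_ext {D D' : Module.End F (TensorAlgebra F V)}
    (h1 : ∀ r, D (algebraMap F _ r) = D' (algebraMap F _ r))
    (hι : ∀ v, D (TensorAlgebra.ι F v) = D' (TensorAlgebra.ι F v))
    (hD : ∀ s t, D (s * t) = D s * t + s * D t)
    (hD' : ∀ s t, D' (s * t) = D' s * t + s * D' t) : D = D' := by
  ext t
  induction t using TensorAlgebra.induction with
  | algebraMap r => exact h1 r
  | ι v => exact hι v
  | mul a b ha hb => rw [hD, hD', ha, hb]
  | add a b ha hb => rw [map_add, map_add, ha, hb]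

/-- `derExt` as a homomorphism of Lie algebras. -/
noncomputable def derExtLie : Module.End F V →ₗ⁅F⁆ Module.End F (TensorAlgebra F V) where
  toFun := derExt
  map_add' d e := derivation_ext (by simp [derExt_algebraMap]) (by simp [derExt_ι])
    (derExt_mul _) (fun s t => by simp only [LinearMap.add_apply, derExt_mul]; noncomm_ring)
  map_smul' r d := derivation_ext (by simp [derExt_algebraMap]) (by simp [derExt_ι])
    (derExt_mul _) (fun s t => by simp [derExt_mul])
  map_lie' {d e} := derivation_ext
    (by simp [derExt_algebraMap, LieRing.of_associative_ring_bracket])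
    (by simp [derExt_ι, LieRing.of_associative_ring_bracket])
    (derExt_mul _) (fun s t => by
      simp only [LieRing.of_associative_ring_bracket, LinearMap.sub_apply, Module.End.mul_apply,
        derExt_mul, map_add]
      noncomm_ring)

/-- The augmentation ideal of `T(V)`, i.e. the elements without constant term: the free
nonunital associative algebra on the vector space `V`. -/
noncomputable def augIdeal (F V : Type*) [Field F] [AddCommGroup V] [Module F V] :
    NonUnitalSubalgebra F (TensorAlgebra F V) where
  carrier := {t | TensorAlgebra.algebraMapInv t = 0}
  add_mem' {a b} ha hb := by
    simp only [Set.mem_ofPred_eq] at *; simp [ha, hb]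
  zero_mem' := by simp
  mul_mem' {a b} ha hb := by
    simp only [Set.mem_ofPred_eq] at *; simp [ha]
  smul_mem' r a ha := by
    simp only [Set.mem_ofPred_eq] at *; simp [ha]

theorem ι_mem_augIdeal (v : V) : TensorAlgebra.ι F v ∈ augIdeal F V := by
  change TensorAlgebra.algebraMapInv (TensorAlgebra.ι F v) = 0
  simp [TensorAlgebra.algebraMapInv]

theorem derExt_mem_augIdeal (d : Module.End F V) (t : TensorAlgebra F V) :
    derExt d t ∈ augIdeal F V := by
  change TensorAlgebra.algebraMapInv (derExt d t) = 0
  induction t using TensorAlgebra.induction with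
  | algebraMap r => simp [derExt_algebraMap]
  | ι v => rw [derExt_ι]; exact ι_mem_augIdeal _
  | mul a b ha hb => simp [derExt_mul, ha, hb]
  | add a b ha hb => simp [ha, hb]

/-- The derivation of the free nonunital algebra on `V` extending `d : V → V`. -/
noncomputable def augDer : Module.End F V →ₗ⁅F⁆ Module.End F (augIdeal F V) where
  toFun d := LinearMap.codRestrict (augIdeal F V).toSubmodule
    (derExt d ∘ₗ (augIdeal F V).toSubmodule.subtype) (fun t => derExt_mem_augIdeal d t)
  map_add' d e := by
    ext t; exact DFunLike.congr_fun (derExtLie.map_add d e) (t : TensorAlgebra F V)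
  map_smul' r d := by
    ext t; exact DFunLike.congr_fun (derExtLie.map_smul r d) (t : TensorAlgebra F V)
  map_lie' {d e} := by
    ext t; exact DFunLike.congr_fun (derExtLie.map_lie d e) (t : TensorAlgebra F V)

end Derivations

/-! ### The free algebra with exponents -/

section FreeExp

variable (F A : Type*) [Field F] [Ring A] [Algebra F A]

/-- For an algebra `A`: the free (nonunital associative) algebra with exponents in `A`. It is
generated by symbols `x_i^u` (`i : ℕ`, `u ∈ A`) that are `F`-linear in `u`, so it is the free
nonunital algebra on the direct sum over the variables `x_i` of copies of `A`. -/
def FreeExp : Type _ := augIdeal F (ℕ →₀ A)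

noncomputable instance : NonUnitalRing (FreeExp F A) :=
  inferInstanceAs (NonUnitalRing (augIdeal F (ℕ →₀ A)))

noncomputable instance : Module F (FreeExp F A) :=
  inferInstanceAs (Module F (augIdeal F (ℕ →₀ A)))

instance : IsScalarTower F (FreeExp F A) (FreeExp F A) :=
  inferInstanceAs (IsScalarTower F (augIdeal F (ℕ →₀ A)) (augIdeal F (ℕ →₀ A)))

instance : SMulCommClass F (FreeExp F A) (FreeExp F A) :=
  inferInstanceAs (SMulCommClass F (augIdeal F (ℕ →₀ A)) (augIdeal F (ℕ →₀ A)))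

variable {F A}

/-- The generator `x_i^u`. -/
noncomputable def xpow (i : ℕ) (u : A) : FreeExp F A :=
  ⟨TensorAlgebra.ι F (Finsupp.single i u), ι_mem_augIdeal _⟩

variable (F A)

/-- For `d ∈ A`, the derivation of the free algebra with exponents such that `x_i^u ↦ x_i^{d u}`
(product of `A`). -/
noncomputable def expDer : A →ₗ⁅F⁆ Module.End F (FreeExp F A) :=
  (augDer (F := F) (V := ℕ →₀ A)).comp (Algebra.lsmul F F (ℕ →₀ A)).toLieHom

variable {F A}

theorem expDer_xpow (d : A) (i : ℕ) (u : A) :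
    expDer F A d (xpow i u) = xpow i (d * u) := by
  apply Subtype.ext
  refine (derExt_ι _ _).trans ?_
  simp [xpow]

theorem expDer_mul (d : A) (f g : FreeExp F A) :
    expDer F A d (f * g) = expDer F A d f * g + f * expDer F A d g :=
  Subtype.ext (derExt_mul _ _ _)

/-- If `A` acts on the algebra `B` through `ρ`, the evaluation of the free algebra with exponents
at `x_i = b i`: the algebra homomorphism with `x_i^u ↦ ρ u (b i)`. -/
noncomputable def expEval {B : Type*} [Ring B] [Algebra F B] (ρ : A →ₗ[F] Module.End F B)
    (b : ℕ → B) : FreeExp F A →ₙₐ[F] B :=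
  ((TensorAlgebra.lift F (Finsupp.lsum F fun i => LinearMap.applyₗ (b i) ∘ₗ ρ) :
    TensorAlgebra F (ℕ →₀ A) →ₐ[F] B) : TensorAlgebra F (ℕ →₀ A) →ₙₐ[F] B).comp
    (NonUnitalSubalgebraClass.subtype (augIdeal F (ℕ →₀ A)))

theorem expEval_xpow {B : Type*} [Ring B] [Algebra F B] (ρ : A →ₗ[F] Module.End F B)
    (b : ℕ → B) (i : ℕ) (u : A) : expEval ρ b (xpow i u) = ρ u (b i) := by
  change TensorAlgebra.lift F (Finsupp.lsum F fun i => LinearMap.applyₗ (b i) ∘ₗ ρ)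
    (TensorAlgebra.ι F (Finsupp.single i u)) = _
  simp

end FreeExp


section Matrices

variable (F : Type*) [Field F] (k : ℕ)

/-- The algebra `M_k(F)`. -/
abbrev Mat := Matrix (Fin k) (Fin k) F

/-- The Lie algebra `L = sl_k(F)`. -/
abbrev L := LieAlgebra.SpecialLinear.sl (Fin k) F

/-- The universal enveloping algebra `U(L)`. -/
abbrev UL := UniversalEnvelopingAlgebra F (L F k)

/-- The action of `L = sl_k(F)` on `M_k(F)` by inner derivations, `c ↦ (x ↦ c x - x c)`. -/
noncomputable def adL : L F k →ₗ⁅F⁆ Module.End F (Mat F k) :=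
  (LieAlgebra.ad F (Mat F k)).comp (L F k).incl

theorem adL_apply (c : L F k) (x : Mat F k) : adL F k c x = c.1 * x - x * c.1 := rfl

/-- The representation `φ : U(L) → End_F(M_k(F))` extending the action of `L`. -/
noncomputable def phi : UL F k →ₐ[F] Module.End F (Mat F k) :=
  UniversalEnvelopingAlgebra.lift F (adL F k)

/-- `U = φ(U(L))`. -/
noncomputable abbrev U : Subalgebra F (Module.End F (Mat F k)) := (phi F k).range

/-- The free algebra with `U`-exponents `F⟨X|U⟩`. Its elements are the `U`-polynomials. -/
noncomputable abbrev FU := FreeExp F (U F k)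

/-- The action of `L` on `F⟨X|U⟩` by derivations with `(x_i^u)^δ = x_i^{u φ(δ)}`, the exponent being
multiplied in `U^op` (so it is the endomorphism `φ(δ) ∘ u`). -/
noncomputable def lieAct : L F k →ₗ⁅F⁆ Module.End F (FU F k) :=
  (expDer F (U F k)).comp ((phi F k).rangeRestrict.toLieHom.comp (UniversalEnvelopingAlgebra.ι F))

/-- The Hopf action of `U(L)` on `F⟨X|U⟩`, as a left action: `act v f` is `f^v`. -/
noncomputable def act : UL F k →ₐ[F] Module.End F (FU F k) :=
  UniversalEnvelopingAlgebra.lift F (lieAct F k)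

variable {F k}

theorem lieAct_xpow (δ : L F k) (i : ℕ) (u : U F k) :
    lieAct F k δ (xpow i u)
      = xpow i ((phi F k).rangeRestrict (UniversalEnvelopingAlgebra.ι F δ) * u) :=
  expDer_xpow _ _ _

theorem lieAct_mul (δ : L F k) (f g : FU F k) :
    lieAct F k δ (f * g) = lieAct F k δ f * g + f * lieAct F k δ g :=
  expDer_mul _ _ _

/-- An `L`-endomorphism of `F⟨X|U⟩`: an algebra endomorphism commuting with the `U(L)`-action. -/
def IsLEndo (ψ : FU F k →ₙₐ[F] FU F k) : Prop :=
  ∀ (v : UL F k) (f : FU F k), ψ (act F k v f) = act F k v (ψ f)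

/-- `T_U`-ideals of `F⟨X|U⟩`: two-sided ideals invariant under the `U(L)`-action and under all
`L`-endomorphisms of `F⟨X|U⟩`. -/
structure IsTUIdeal (I : Submodule F (FU F k)) : Prop where
  mul_mem_left : ∀ g, ∀ f ∈ I, g * f ∈ I
  mul_mem_right : ∀ g, ∀ f ∈ I, f * g ∈ I
  act_mem : ∀ v : UL F k, ∀ f ∈ I, act F k v f ∈ I
  endo_mem : ∀ ψ : FU F k →ₙₐ[F] FU F k, IsLEndo ψ → ∀ f ∈ I, ψ f ∈ I

/-- The `T_U`-ideal generated by `S`: the intersection of all `T_U`-ideals containing `S`. -/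
noncomputable def TUspan (S : Set (FU F k)) : Submodule F (FU F k) :=
  sInf {I | IsTUIdeal I ∧ S ⊆ I}

theorem TUspan_isLeast (S : Set (FU F k)) : IsLeast {I | IsTUIdeal I ∧ S ⊆ I} (TUspan S) := by
  refine ⟨⟨⟨?_, ?_, ?_, ?_⟩, ?_⟩, fun I hI => sInf_le hI⟩
  · intro g f hf
    simp only [TUspan, Submodule.mem_sInf] at hf ⊢
    exact fun I hI => hI.1.mul_mem_left g f (hf I hI)
  · intro g f hf
    simp only [TUspan, Submodule.mem_sInf] at hf ⊢
    exact fun I hI => hI.1.mul_mem_right g f (hf I hI)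
  · intro v f hf
    simp only [TUspan, Submodule.mem_sInf] at hf ⊢
    exact fun I hI => hI.1.act_mem v f (hf I hI)
  · intro ψ hψ f hf
    simp only [TUspan, Submodule.mem_sInf] at hf ⊢
    exact fun I hI => hI.1.endo_mem ψ hψ f (hf I hI)
  · intro f hf
    simp only [TUspan, SetLike.mem_coe, Submodule.mem_sInf]
    exact fun I hI => hI.2 hf

variable (F k)

/-- Evaluation of `U`-polynomials at `x_i = a i ∈ M_k(F)`: the algebra homomorphism
with `x_i^u ↦ u (a i)`. -/
noncomputable def evalU (a : ℕ → Mat F k) : FU F k →ₙₐ[F] Mat F k :=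
  expEval (U F k).val.toLinearMap a

/-- The `U`-identities of `M_k(F)`: the `U`-polynomials all of whose evaluations vanish. -/
noncomputable def UIdentities : Submodule F (FU F k) where
  carrier := {f | ∀ a : ℕ → Mat F k, evalU F k a f = 0}
  add_mem' {f g} hf hg a := by rw [map_add, hf a, hg a, add_zero]
  zero_mem' a := map_zero _
  smul_mem' r f hf a := by rw [map_smul, hf a, smul_zero]

variable {k} in
theorem adL_mem (c : L F k) : adL F k c ∈ U F k :=
  ⟨UniversalEnvelopingAlgebra.ι F c, UniversalEnvelopingAlgebra.lift_ι_apply F _ c⟩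

variable {k} in
/-- The inner derivation of `e_{ij}`. -/
noncomputable def adE (i j : Fin k) (hij : i ≠ j) : Module.End F (Mat F k) :=
  adL F k (LieAlgebra.SpecialLinear.single i j hij 1)

variable {k} in
theorem adE_apply (i j : Fin k) (hij : i ≠ j) (x : Mat F k) :
    adE F i j hij x = Matrix.single i j 1 * x - x * Matrix.single i j 1 := rfl

/-! ### The basis of `M_k(F)` and the endomorphisms `φ_{ab}` -/

/-- Index set of the basis `{g, h_l, e_{ij}}` of `M_k(F)`. -/
inductive BIdx (k : ℕ) : Type
  | g : BIdx k
  | h (l : Fin (k - 1)) : BIdx k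
  | e (i j : Fin k) (hij : i ≠ j) : BIdx k

instance : Finite (BIdx k) := by
  let f : Option (Fin (k - 1) ⊕ {p : Fin k × Fin k // p.1 ≠ p.2}) → BIdx k
    | none => .g
    | some (.inl l) => .h l
    | some (.inr p) => .e p.1.1 p.1.2 p.2
  refine Finite.of_surjective f ?_
  rintro (_ | l | ⟨i, j, hij⟩)
  · exact ⟨none, rfl⟩
  · exact ⟨some (.inl l), rfl⟩
  · exact ⟨some (.inr ⟨(i, j), hij⟩), rfl⟩

variable {k}

/-- The row index `l` of `h_l`. -/
def lo (l : Fin (k - 1)) : Fin k := ⟨l, by omega⟩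

/-- The row index `l + 1` of `h_l`. -/
def hi (l : Fin (k - 1)) : Fin k := ⟨l + 1, by omega⟩

/-- The matrices `g = I_k`, `h_l = e_{l,l} - e_{l+1,l+1}` and `e_{ij}` (`i ≠ j`). -/
def bvec : BIdx k → Mat F k
  | .g => 1
  | .h l => Matrix.single (lo l) (lo l) 1 - Matrix.single (hi l) (hi l) 1
  | .e i j _ => Matrix.single i j 1

/-- The coordinate functionals of the basis `bvec`. -/
noncomputable def bcoord : BIdx k → Module.Dual F (Mat F k)
  | .g => (k : F)⁻¹ • Matrix.traceLinearMap (Fin k) F F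
  | .h l => ∑ i ∈ Finset.Iic (lo l),
      (Matrix.entryLinearMap F F i i - (k : F)⁻¹ • Matrix.traceLinearMap (Fin k) F F)
  | .e i j _ => Matrix.entryLinearMap F F i j

variable [CharZero F]

theorem dualBases (hk : 2 ≤ k) : Module.DualBases (bvec F (k := k)) (bcoord F) where
  eval_same := by
    have hk0 : (k : F) ≠ 0 := Nat.cast_ne_zero.2 (by omega)
    rintro (_ | l | ⟨i, j, hij⟩)
    · simp [bvec, bcoord, hk0]
    · simp [bvec, bcoord, lo, hi, Matrix.single_apply]
    · simp [bvec, bcoord]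
  eval_of_ne := by
    have hk0 : (k : F) ≠ 0 := Nat.cast_ne_zero.2 (by omega)
    rintro (_ | l | ⟨i, j, hij⟩) (_ | l' | ⟨i', j', hij'⟩) hne
    · exact absurd rfl hne
    · simp [bvec, bcoord]
    · simp [bvec, bcoord, Matrix.trace_single_eq_of_ne _ _ _ hij']
    · simp [bvec, bcoord, hk0]
    · have hll : (l : ℕ) ≠ l' := fun h => hne (by rw [Fin.ext h])
      simp only [bvec, bcoord, lo, hi, LinearMap.sum_apply, LinearMap.sub_apply,
        LinearMap.smul_apply, Matrix.traceLinearMap_apply, Matrix.trace_sub,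
        Matrix.trace_single_eq_same, sub_self, smul_zero, Matrix.entryLinearMap_apply,
        Matrix.sub_apply, Matrix.single_apply, and_self, Finset.sum_sub_distrib,
        Finset.sum_ite_eq, Finset.mem_Iic, Fin.mk_le_mk]
      split_ifs <;> first | omega | simp
    · simp only [bvec, bcoord, LinearMap.sum_apply, LinearMap.sub_apply,
        LinearMap.smul_apply, Matrix.traceLinearMap_apply, Matrix.trace_single_eq_of_ne _ _ _ hij',
        smul_zero, sub_zero, Matrix.entryLinearMap_apply, Matrix.single_apply]
      refine Finset.sum_eq_zero fun x _ => if_neg ?_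
      rintro ⟨rfl, rfl⟩
      exact hij' rfl
    · simp [bvec, bcoord, hij]
    · have h1 : ∀ a : Fin k, ¬ (a = i ∧ a = j) := by
        rintro a ⟨rfl, rfl⟩
        exact hij rfl
      simp [bvec, bcoord, h1]
    · have h1 : ¬ (i' = i ∧ j' = j) := by
        rintro ⟨rfl, rfl⟩
        exact hne rfl
      simp [bvec, bcoord, h1]
  total := by
    intro x y hxy
    have hg := hxy .g
    have hh := fun l => hxy (.h l)
    have he := fun i j hij => hxy (.e i j hij)
    have hk0 : (k : F) ≠ 0 := Nat.cast_ne_zero.2 (by omega)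
    simp only [bcoord, LinearMap.smul_apply, Matrix.traceLinearMap_apply, smul_eq_mul,
      mul_eq_mul_left_iff, inv_eq_zero, hk0, or_false] at hg
    simp only [bcoord, LinearMap.sum_apply, LinearMap.sub_apply, LinearMap.smul_apply,
      Matrix.traceLinearMap_apply, Matrix.entryLinearMap_apply, hg, Finset.sum_sub_distrib,
      sub_left_inj] at hh
    simp only [bcoord, Matrix.entryLinearMap_apply] at he
    have key : ∀ n (hn : n < k), ∑ i ∈ Finset.Iic (⟨n, hn⟩ : Fin k), x i i
        = ∑ i ∈ Finset.Iic (⟨n, hn⟩ : Fin k), y i i := by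
      intro n hn
      by_cases h : n < k - 1
      · exact hh ⟨n, h⟩
      · have : Finset.Iic (⟨n, hn⟩ : Fin k) = Finset.univ := by
          ext i; simp [Fin.le_def]; omega
        rw [this]
        exact hg
    have diag : ∀ n (hn : n < k), x ⟨n, hn⟩ ⟨n, hn⟩ = y ⟨n, hn⟩ ⟨n, hn⟩ := by
      intro n hn
      have split : ∀ z : Mat F k, ∑ i ∈ Finset.Iic (⟨n, hn⟩ : Fin k), z i i
          = z ⟨n, hn⟩ ⟨n, hn⟩ + ∑ i ∈ Finset.Iio (⟨n, hn⟩ : Fin k), z i i := by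
        intro z
        rw [← Finset.Iio_insert, Finset.sum_insert (by simp)]
      have hlt : ∑ i ∈ Finset.Iio (⟨n, hn⟩ : Fin k), x i i
          = ∑ i ∈ Finset.Iio (⟨n, hn⟩ : Fin k), y i i := by
        rcases n with _ | n
        · have : Finset.Iio (⟨0, hn⟩ : Fin k) = ∅ := by
            ext i; simp [Fin.lt_def]
          simp [this]
        · have : Finset.Iio (⟨n + 1, hn⟩ : Fin k) = Finset.Iic ⟨n, by omega⟩ := by
            ext i; simp [Fin.lt_def, Fin.le_def]
          rw [this]
          exact key n _
      have := key n hn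
      rw [split x, split y, hlt] at this
      exact add_right_cancel this
    ext i j
    by_cases hij : i = j
    · subst hij
      exact diag i.1 i.2
    · exact he i j hij

/-- The basis `𝓜 = {g, h_l, e_{ij}}` of `M_k(F)`. -/
noncomputable def basisM (hk : 2 ≤ k) : Module.Basis (BIdx k) F (Mat F k) :=
  (dualBases F hk).basis

theorem basisM_apply (hk : 2 ≤ k) (a : BIdx k) : basisM F hk a = bvec F a := by
  simp [basisM]

theorem basisM_coord (hk : 2 ≤ k) (a : BIdx k) : (basisM F hk).coord a = bcoord F a := by
  ext x
  rfl

/-- The endomorphism `φ_{ab}` of `M_k(F)`: it maps the basis element `a` to the basis element `b`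
and all other basis elements to `0`, i.e. `φ_{ab}(x) = μ_a^x b`. -/
noncomputable def phiAB (hk : 2 ≤ k) (a b : BIdx k) : Module.End F (Mat F k) :=
  ((basisM F hk).coord a).smulRight (basisM F hk b)

theorem phiAB_apply (hk : 2 ≤ k) (a b : BIdx k) (x : Mat F k) :
    phiAB F hk a b x = bcoord F a x • bvec F b := by
  rw [phiAB, LinearMap.smulRight_apply, basisM_coord, basisM_apply]

theorem phi_flip_eq (hk : 2 ≤ k) (i j : Fin k) (hij : i ≠ j) :
    phiAB F hk (.e i j hij) (.e j i hij.symm)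
      = (-(2 : F)⁻¹) • (adE F j i hij.symm * adE F j i hij.symm) := by
  ext x : 1
  have h0 : (Matrix.single j i 1 * Matrix.single j i 1 : Mat F k) = 0 := by
    simp [hij]
  have h1 : (Matrix.single j i 1 * x * Matrix.single j i 1 : Mat F k)
      = x i j • Matrix.single j i 1 := by
    ext a b
    simp [Matrix.single_mul_mul_single, Matrix.single_apply]
  rw [phiAB_apply]
  simp only [LinearMap.smul_apply, Module.End.mul_apply, adE_apply, mul_sub, sub_mul]
  rw [← mul_assoc, h0, zero_mul, mul_assoc x, h0, mul_zero, ← mul_assoc, h1]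
  simp only [bcoord, bvec, Matrix.entryLinearMap_apply]
  rw [zero_sub, sub_zero, ← neg_add', ← two_smul F, smul_neg, smul_smul, neg_mul,
    inv_mul_cancel₀ two_ne_zero, neg_smul, one_smul, neg_neg]

theorem phi_flip_mem (hk : 2 ≤ k) (i j : Fin k) (hij : i ≠ j) :
    phiAB F hk (.e i j hij) (.e j i hij.symm) ∈ U F k := by
  rw [phi_flip_eq]
  exact Subalgebra.smul_mem _ (Subalgebra.mul_mem _ (adL_mem F _) (adL_mem F _)) _

theorem phi_same_mem (hk : 2 ≤ k) (i j : Fin k) (hij : i ≠ j) :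
    phiAB F hk (.e i j hij) (.e i j hij) ∈ U F k := by
  have : phiAB F hk (.e i j hij) (.e i j hij)
      = phiAB F hk (.e j i hij.symm) (.e i j hij) * phiAB F hk (.e i j hij) (.e j i hij.symm) := by
    ext x : 1
    simp [phiAB_apply, bcoord, bvec]
  rw [this]
  exact Subalgebra.mul_mem _ (phi_flip_mem F hk j i hij.symm) (phi_flip_mem F hk i j hij)

theorem phi_three_mem (hk : 2 ≤ k) (i j l : Fin k) (hij : i ≠ j) (hli : l ≠ i) (hlj : l ≠ j) :
    phiAB F hk (.e i j hij) (.e l i hli) ∈ U F k := by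
  have : phiAB F hk (.e i j hij) (.e l i hli)
      = adE F l j hlj * phiAB F hk (.e i j hij) (.e j i hij.symm) := by
    ext x : 1
    simp [phiAB_apply, bcoord, bvec, adE_apply, hli.symm]
  rw [this]
  exact Subalgebra.mul_mem _ (adL_mem F _) (phi_flip_mem F hk i j hij)

theorem adE_diag_mem (i : Fin k) :
    (LieAlgebra.ad F (Mat F k) (Matrix.single i i 1) : Module.End F (Mat F k)) ∈ U F k := by
  rcases k with _ | k
  · exact i.elim0
  have hk0 : ((k : F) + 1) ≠ 0 := by exact_mod_cast Nat.succ_ne_zero k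
  let c : L F (k + 1) := ⟨Matrix.single i i 1 - ((k + 1 : ℕ) : F)⁻¹ • 1, by
    change Matrix.trace (Matrix.single i i 1 - ((k + 1 : ℕ) : F)⁻¹ • (1 : Mat F (k + 1))) = 0
    simp [hk0]⟩
  convert adL_mem F c using 1
  ext x : 1
  rw [adL_apply]
  simp [LieAlgebra.ad_apply, Ring.lie_def, c, sub_mul, mul_sub]

theorem phi_gg_eq (hk : 2 ≤ k) : phiAB F hk .g .g
    = 1 - (2 * (k : F))⁻¹ • ∑ i : Fin k, ∑ j : Fin k,
      (LieAlgebra.ad F (Mat F k) (Matrix.single i j 1) : Module.End F (Mat F k)) *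
        LieAlgebra.ad F (Mat F k) (Matrix.single j i 1) := by
  have hk0 : (k : F) ≠ 0 := Nat.cast_ne_zero.2 (by omega)
  ext x : 1
  have hs : ∑ i : Fin k, ∑ j : Fin k, (LieAlgebra.ad F (Mat F k) (Matrix.single i j 1) *
      LieAlgebra.ad F (Mat F k) (Matrix.single j i 1)) x
      = (2 * (k : F)) • x - (2 * x.trace) • (1 : Mat F k) := by
    have h1 : ∀ i j : Fin k, (LieAlgebra.ad F (Mat F k) (Matrix.single i j 1) *
        LieAlgebra.ad F (Mat F k) (Matrix.single j i 1)) x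
        = Matrix.single i i 1 * x - x j j • Matrix.single i i 1
          - (x i i • Matrix.single j j 1 - x * Matrix.single j j 1) := by
      intro i j
      have h2 : ∀ i j : Fin k, (Matrix.single i j 1 * x * Matrix.single j i 1 : Mat F k)
          = x j j • Matrix.single i i 1 := by
        intro i j
        simp [Matrix.single_mul_mul_single]
      change Matrix.single i j 1 * (Matrix.single j i 1 * x - x * Matrix.single j i 1)
        - (Matrix.single j i 1 * x - x * Matrix.single j i 1) * Matrix.single i j 1 = _
      simp only [mul_sub, sub_mul]
      rw [← mul_assoc (Matrix.single i j 1) x, h2, h2, ← mul_assoc, mul_assoc x]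
      simp only [Matrix.single_mul_single_same, mul_one]
    have ht : ∑ i : Fin k, x i i = x.trace := rfl
    have h3 : ∑ i : Fin k, (Matrix.single i i 1 : Mat F k) = 1 :=
      Matrix.sum_single_one
    simp only [h1, Finset.sum_sub_distrib, ← Finset.sum_mul, ← Finset.mul_sum, ← Finset.smul_sum,
      ← Finset.sum_smul, h3, Finset.sum_const, Finset.card_univ, Fintype.card_fin, one_mul,
      mul_one, ht, smul_mul_assoc,
      ← Nat.cast_smul_eq_nsmul F]
    module
  rw [phiAB_apply]
  simp only [LinearMap.sub_apply, LinearMap.smul_apply, LinearMap.sum_apply, hs, smul_sub,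
    smul_smul, Module.End.one_apply, bcoord, bvec, Matrix.traceLinearMap_apply, smul_eq_mul]
  rw [inv_mul_cancel₀ (by simpa using hk0), one_smul, sub_sub_cancel]
  congr 1
  field_simp

theorem phi_gg_mem (hk : 2 ≤ k) : phiAB F hk .g .g ∈ U F k := by
  rw [phi_gg_eq]
  refine Subalgebra.sub_mem _ (Subalgebra.one_mem _) (Subalgebra.smul_mem _
    (Subalgebra.sum_mem _ fun i _ => Subalgebra.sum_mem _ fun j _ => ?_) _)
  by_cases hij : i = j
  · subst hij
    exact Subalgebra.mul_mem _ (adE_diag_mem F i) (adE_diag_mem F i)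
  · exact Subalgebra.mul_mem _ (adL_mem F (LieAlgebra.SpecialLinear.single i j hij 1))
      (adL_mem F (LieAlgebra.SpecialLinear.single j i (Ne.symm hij) 1))

/-- The basis element `e_{12}` (indices of `Fin k` start from `0`). -/
def e12 (hk : 2 ≤ k) : BIdx k := .e ⟨0, by omega⟩ ⟨1, by omega⟩ (by simp)

/-- The basis element `e_{21}`. -/
def e21 (hk : 2 ≤ k) : BIdx k := .e ⟨1, by omega⟩ ⟨0, by omega⟩ (by simp)

/-- The basis element `e_{31}`. -/
def e31 (hk : 3 ≤ k) : BIdx k := .e ⟨2, by omega⟩ ⟨0, by omega⟩ (by simp)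

/-- `φ_{gg}` as an element of `U`. -/
noncomputable def exp_gg (hk : 2 ≤ k) : U F k := ⟨phiAB F hk .g .g, phi_gg_mem F hk⟩

/-- `φ_{e12 e12}` as an element of `U`. -/
noncomputable def exp_e12_e12 (hk : 2 ≤ k) : U F k :=
  ⟨phiAB F hk (e12 hk) (e12 hk), phi_same_mem F hk _ _ _⟩

/-- `φ_{e12 e21}` as an element of `U`. -/
noncomputable def exp_e12_e21 (hk : 2 ≤ k) : U F k :=
  ⟨phiAB F hk (e12 hk) (e21 hk), phi_flip_mem F hk _ _ _⟩

/-- `φ_{e12 e31}` as an element of `U`. -/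
noncomputable def exp_e12_e31 (hk : 3 ≤ k) : U F k :=
  ⟨phiAB F (le_trans (by decide) hk) (e12 (le_trans (by decide) hk)) (e31 hk),
    phi_three_mem F _ _ _ _ _ (by simp) (by simp)⟩

end Matrices

end DiffMat

open DiffMat

/-!
The four polynomials are identities by inspection, and the `U`-identities form a `T_U`-ideal
because evaluations intertwine the actions of `U(L)`. For the converse let `I` be a `T_U`-ideal
that contains the four polynomials.

As an `L`-module `M_k(F)` is the sum of the scalar matrices and of the simple module `sl_k`, so
`U` is spanned by `φ_{gg}` and by the maps `x ↦ f(x) b` with `f(1) = 0` and `b` traceless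
(`smulRight_mem_U`, `mem_span_letterU`). Hence the free algebra is generated by the `x_n^{gg}` and
by *letters* `x_n^{a b}`, where the *type* `(n, a)` consists of a variable and of a basis element
`a ≠ g`, and `b` is a traceless matrix. Right multiplication of exponents commutes with the action
of `L`, so the generators may be used with arbitrary types (`isLEndo_subst`).

* The last two polynomials make the `x_n^{gg}` central modulo `I` (`central_of_mem`).
* The kernel of the product `sl_k ⊗ sl_k → M_k(F)` is generated as an `L`-module by `e_{12} ⊗
  e_{31}`, or `e_{12} ⊗ e_{12}` for `k = 2` (`Equivariant.factor_large`,
  `Equivariant.factor_two`). So by the first polynomial the product of two letters modulo `I`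
  depends, apart from the types, only on the product of the two matrices.
* It does not change if the two types are exchanged: the difference is a linear map on `M_k(F)`
  whose kernel is `L`-stable and by the second polynomial contains `e_{11}`, hence everything
  (`eq_top_of_stable`, `exists_factor_letterA`).
* These quadratic relations determine all longer words (`mul_of_factor`, `normalWord_append`,
  `normalWord_perm`): a word depends modulo `I` only on the multiset of its types and on the
  product of its matrices (`exists_normalForm`).

The value of a word on generic matrices is the monomial of its types times the product of its
matrices, so a word modulo `I` is a linear function of its generic value. A `U`-identity vanishes
on generic matrices, because `F` is infinite (`generic_eq_zero`), and so it lies in `I`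
(`UIdentities_le`).
-/

namespace DiffMat

/-! ### Matrix units and subspaces stable under their commutators -/

section MatrixUnits

variable {F : Type*} [Field F] {k : ℕ}

variable (F) in
/-- The matrix unit `e_{ij}`. -/
abbrev E (i j : Fin k) : Mat F k := Matrix.single i j 1

theorem E_mul (i j p q : Fin k) : E F i j * E F p q = if j = p then E F i q else 0 := by
  split_ifs with h
  · subst h; simp
  · simp [h]

/-- The traceless matrices are spanned by the `e_{ij}`, `i ≠ j`, and the `e_{ii} - e_{jj}`. -/
theorem mem_of_trace_eq_zero {S : Submodule F (Mat F k)}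
    (hE : ∀ i j, i ≠ j → E F i j ∈ S) (hH : ∀ i j, i ≠ j → E F i i - E F j j ∈ S)
    {m : Mat F k} (hm : m.trace = 0) : m ∈ S := by
  rcases k with _ | k
  · rw [Subsingleton.elim m 0]; exact S.zero_mem
  have h1 : m = ∑ i, ∑ j, m i j • (E F i j - if i = j then E F 0 0 else 0) := by
    simp only [smul_sub, Finset.sum_sub_distrib]
    have : ∑ i, ∑ j, m i j • (if i = j then E F (0 : Fin (k + 1)) 0 else 0) = 0 := by
      simp only [smul_ite, smul_zero, Finset.sum_ite_eq, Finset.mem_univ, if_true,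
        ← Finset.sum_smul]
      rw [show ∑ i, m i i = 0 from hm, zero_smul]
    rw [this, sub_zero]
    conv_lhs => rw [Matrix.matrix_eq_sum_single m]
    simp [Matrix.smul_single]
  rw [h1]
  refine S.sum_mem fun i _ => S.sum_mem fun j _ => S.smul_mem _ ?_
  by_cases hij : i = j
  · subst hij
    by_cases hi : i = 0
    · subst hi; simp
    · simpa using hH i 0 hi
  · simpa [hij] using hE i j hij

theorem mat_ext {N : Type*} [AddCommGroup N] [Module F N] {f g : Mat F k →ₗ[F] N}
    (h : ∀ i j, f (E F i j) = g (E F i j)) : f = g := by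
  ext m
  rw [Matrix.matrix_eq_sum_single m]
  simp only [map_sum]
  refine Finset.sum_congr rfl fun i _ => Finset.sum_congr rfl fun j _ => ?_
  have : Matrix.single i j (m i j) = m i j • E F i j := by simp [Matrix.smul_single]
  rw [this, map_smul, map_smul, h]

/-- `sl_k` is an irreducible module over itself: a subspace of `M_k(F)` stable under commutators
with the `e_{ij}` that contains one of the `e_{ij}` contains all traceless matrices. -/
theorem mem_of_stable [CharZero F] {S : Submodule F (Mat F k)}
    (hS : ∀ i j, i ≠ j → ∀ m ∈ S, E F i j * m - m * E F i j ∈ S)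
    {i j : Fin k} (hij : i ≠ j) (h : E F i j ∈ S) {m : Mat F k} (hm : m.trace = 0) : m ∈ S := by
  have row : ∀ p i j, i ≠ j → p ≠ j → E F i j ∈ S → E F p j ∈ S := by
    intro p i j hij hpj h
    by_cases hpi : p = i
    · rwa [hpi]
    · simpa [E_mul, hpj.symm, hpi] using hS p i hpi _ h
  have col : ∀ q i j, i ≠ j → i ≠ q → E F i j ∈ S → E F i q ∈ S := by
    intro q i j hij hiq h
    by_cases hqj : q = j
    · rwa [hqj]
    · have := S.neg_mem (hS j q (Ne.symm hqj) _ h)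
      simpa [E_mul, hiq.symm] using this
  have flip : ∀ i j, i ≠ j → E F i j ∈ S → E F j i ∈ S := by
    intro i j hij h
    have h1 := hS j i hij.symm _ (hS j i hij.symm _ h)
    have h2 := S.smul_mem (-(2 : F)⁻¹) h1
    convert h2 using 1
    simp only [E_mul, if_true, mul_sub, sub_mul, hij, if_false]
    rw [zero_sub, sub_zero, ← neg_add', ← two_smul F, smul_neg, neg_smul, neg_neg, smul_smul,
      inv_mul_cancel₀ two_ne_zero, one_smul]
  have all : ∀ p q, p ≠ q → E F p q ∈ S := by
    intro p q hpq
    by_cases hqi : q = i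
    · subst hqi
      by_cases hpj : p = j
      · subst hpj; exact flip _ _ hij h
      · exact col _ _ _ hpj hpq (row p _ _ hij hpj h)
    · exact row p i q (Ne.symm hqi) hpq (col q _ _ hij (Ne.symm hqi) h)
  refine mem_of_trace_eq_zero all (fun i j hij => ?_) hm
  simpa [E_mul] using hS i j hij _ (all j i hij.symm)

/-- A subspace of `M_k(F)` stable under commutators with the `e_{ij}` that contains one of the
`e_{ii}` is everything. -/
theorem eq_top_of_stable {S : Submodule F (Mat F k)}
    (hS : ∀ i j, i ≠ j → ∀ m ∈ S, E F i j * m - m * E F i j ∈ S)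
    {i : Fin k} (h : E F i i ∈ S) : S = ⊤ := by
  have col : ∀ p, E F p i ∈ S := by
    intro p
    by_cases hp : p = i
    · rwa [hp]
    · simpa [E_mul, Ne.symm hp] using hS p i hp _ h
  have all : ∀ p q, E F p q ∈ S := by
    intro p q
    by_cases hq : q = i
    · rw [hq]; exact col p
    · have h1 := hS i q (Ne.symm hq) _ (col p)
      have h2 := S.neg_mem h1
      by_cases hqp : q = p
      · subst hqp
        have h3 := S.add_mem h2 h
        simpa [E_mul] using h3
      · simpa [E_mul, hqp] using h2
  rw [eq_top_iff]
  intro m _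
  rw [Matrix.matrix_eq_sum_single m]
  refine S.sum_mem fun p _ => S.sum_mem fun q _ => ?_
  have : Matrix.single p q (m p q) = m p q • E F p q := by simp [Matrix.smul_single]
  rw [this]
  exact S.smul_mem _ (all p q)

end MatrixUnits

/-! ### Equivariant bilinear maps that factor through the matrix product -/

section Factor

variable {F : Type*} [Field F] {k : ℕ} {A : Type*} [AddCommGroup A] [Module F A]

/-- A bilinear map on `M_k(F)` is equivariant if each commutator with some `e_{ij}`, `i ≠ j`, is
compatible with some linear operator on the target. -/
def Equivariant (B : Mat F k →ₗ[F] Mat F k →ₗ[F] A) : Prop :=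
  ∀ i j : Fin k, i ≠ j → ∃ D : A →ₗ[F] A, ∀ a b,
    D (B a b) = B (E F i j * a - a * E F i j) b + B a (E F i j * b - b * E F i j)

variable {B : Mat F k →ₗ[F] Mat F k →ₗ[F] A}

theorem Equivariant.of_eq_zero (hB : Equivariant B) {a b : Mat F k} (h : B a b = 0)
    {i j : Fin k} (hij : i ≠ j) :
    B (E F i j * a - a * E F i j) b + B a (E F i j * b - b * E F i j) = 0 := by
  obtain ⟨D, hD⟩ := hB i j hij
  rw [← hD, h, map_zero]

theorem Equivariant.of_eq_neg (hB : Equivariant B) {a b a' b' : Mat F k} (h : B a b = -B a' b')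
    {i j : Fin k} (hij : i ≠ j) :
    B (E F i j * a - a * E F i j) b + B a (E F i j * b - b * E F i j) =
      -(B (E F i j * a' - a' * E F i j) b' + B a' (E F i j * b' - b' * E F i j)) := by
  obtain ⟨D, hD⟩ := hB i j hij
  rw [← hD, ← hD, h, map_neg]

/-! Commutators with matrix units move the relation `B e_{ij} e_{pi} = 0`, for distinct `i`, `j`,
`p`, to the pairs of other weights and permute the indices. -/

section Moves

variable (hB : Equivariant B) {i j p : Fin k} (hij : i ≠ j) (hip : i ≠ p)
include hB hij hip

theorem Equivariant.apply_diag_left (h : B (E F i j) (E F p i) = 0) :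
    B (E F j j - E F i i) (E F p i) = 0 := by
  have h1 := hB.of_eq_zero h hij.symm
  simpa [E_mul, hip, hij, hij.symm] using h1

theorem Equivariant.apply_diag_right (h : B (E F i j) (E F p i) = 0) :
    B (E F i j) (E F i i - E F p p) = 0 := by
  have h1 := hB.of_eq_zero h hip
  simpa [E_mul, hip.symm, hij.symm] using h1

variable [CharZero F]

theorem Equivariant.apply_twice_left (h : B (E F i j) (E F p i) = 0) :
    B (E F j i) (E F p i) = 0 := by
  have h1 := hB.of_eq_zero (hB.apply_diag_left hij hip h) hij.symm
  simp [mul_sub, sub_mul, hip, hij] at h1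
  linear_combination (norm := module) (-(2 : F)⁻¹) • h1

theorem Equivariant.apply_twice_right (h : B (E F i j) (E F p i) = 0) :
    B (E F i j) (E F i p) = 0 := by
  have h1 := hB.of_eq_zero (hB.apply_diag_right hij hip h) hip
  simp [mul_sub, sub_mul, hip.symm, hij.symm] at h1
  linear_combination (norm := module) (-(2 : F)⁻¹) • h1

omit [CharZero F] in
theorem Equivariant.change (h : B (E F i j) (E F p i) = 0) {a : Fin k} (hai : a ≠ i)
    (haj : a ≠ j) (hap : a ≠ p) : B (E F a j) (E F p a) = 0 := by
  have h1 := hB.of_eq_zero h hai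
  simp [hip, haj.symm, hai.symm] at h1
  have h2 := hB.of_eq_zero h1 hai.symm
  simp [hij.symm, hap] at h2
  linear_combination (norm := module) h - h2

variable (hjp : j ≠ p)
include hjp

theorem Equivariant.swap_left (h : B (E F i j) (E F p i) = 0) :
    B (E F j i) (E F p j) = 0 := by
  have h1 := hB.apply_diag_left hij hip h
  have h2 := hB.of_eq_zero (hB.apply_twice_left hij hip h) hij
  simp [hjp] at h1 h2
  linear_combination (norm := module) -h1 - h2

theorem Equivariant.swap_right (h : B (E F i j) (E F p i) = 0) :
    B (E F p j) (E F i p) = 0 := by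
  have h1 := hB.apply_diag_right hij hip h
  have h2 := hB.of_eq_zero (hB.apply_twice_right hij hip h) hip.symm
  simp [hjp] at h1 h2
  linear_combination (norm := module) h1 + h2

end Moves

variable [CharZero F] (hB : Equivariant B)
include hB

/-- A relation `B e_{ij} e_{pi} = 0` for one triple of distinct indices holds for all such triples:
the indices are put in place one after the other, by exchanges and replacements. -/
theorem Equivariant.of_distinct {i j p : Fin k} (hij : i ≠ j) (hip : i ≠ p) (hjp : j ≠ p)
    (h : B (E F i j) (E F p i) = 0) {a b c : Fin k} (hab : a ≠ b) (hac : a ≠ c) (hbc : b ≠ c) :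
    B (E F a b) (E F c a) = 0 := by
  obtain ⟨j, p, haj, hap, hjp, h⟩ : ∃ j p, a ≠ j ∧ a ≠ p ∧ j ≠ p ∧ B (E F a j) (E F p a) = 0 := by
    by_cases h1 : a = i
    · subst h1; exact ⟨j, p, hij, hip, hjp, h⟩
    by_cases h2 : a = j
    · subst h2; exact ⟨i, p, hij.symm, hjp, hip, hB.swap_left hij hip hjp h⟩
    by_cases h3 : a = p
    · subst h3; exact ⟨j, i, hjp.symm, hip.symm, hij.symm, hB.swap_right hij hip hjp h⟩
    exact ⟨j, p, h2, h3, hjp, hB.change hij hip h h1 h2 h3⟩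
  have change_mid : ∀ {x y z w : Fin k}, x ≠ y → x ≠ z → y ≠ z → w ≠ x → w ≠ y → w ≠ z →
      B (E F x y) (E F z x) = 0 → B (E F x w) (E F z x) = 0 := fun hxy hxz hyz hwx hwy hwz h =>
    hB.swap_left hwx hwz hxz (hB.change hxy.symm hyz (hB.swap_left hxy hxz hyz h) hwy hwx hwz)
  have change_last : ∀ {x y z w : Fin k}, x ≠ y → x ≠ z → y ≠ z → w ≠ x → w ≠ y → w ≠ z →
      B (E F x y) (E F z x) = 0 → B (E F x y) (E F w x) = 0 := fun hxy hxz hyz hwx hwy hwz h =>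
    hB.swap_right hwy hwx hxy.symm
      (hB.change hyz.symm hxz.symm (hB.swap_right hxy hxz hyz h) hwz hwy hwx)
  have swap_last : ∀ {x y z : Fin k}, x ≠ y → x ≠ z → y ≠ z →
      B (E F x y) (E F z x) = 0 → B (E F x z) (E F y x) = 0 := fun hxy hxz hyz h =>
    hB.swap_left hxz.symm hyz.symm hxy
      (hB.swap_right hxy.symm hyz hxz (hB.swap_left hxy hxz hyz h))
  obtain ⟨p, hap, hbp, h⟩ : ∃ p, a ≠ p ∧ b ≠ p ∧ B (E F a b) (E F p a) = 0 := by
    by_cases h2 : b = j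
    · subst h2; exact ⟨p, hap, hjp, h⟩
    by_cases h3 : b = p
    · subst h3; exact ⟨j, haj, hjp.symm, swap_last haj hap hjp h⟩
    exact ⟨p, hap, h3, change_mid haj hap hjp hab.symm h2 h3 h⟩
  by_cases h3 : c = p
  · rwa [h3]
  exact change_last hab hap hbp hac.symm hbc.symm h3 h

/-- For `k ≥ 3`, one vanishing product `e_{ij} e_{pi} = 0` forces the others. -/
theorem Equivariant.of_ne {i j p : Fin k} (hij : i ≠ j) (hip : i ≠ p) (hjp : j ≠ p)
    (h : B (E F i j) (E F p i) = 0) {a b c d : Fin k} (hab : a ≠ b) (hcd : c ≠ d) (hbc : b ≠ c) :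
    B (E F a b) (E F c d) = 0 := by
  have h0 : ∀ {a b c : Fin k}, a ≠ b → a ≠ c → b ≠ c → B (E F a b) (E F c a) = 0 :=
    fun hab hac hbc => hB.of_distinct hij hip hjp h hab hac hbc
  have third : ∀ a b : Fin k, ∃ c, a ≠ c ∧ b ≠ c := by
    intro a b
    by_contra! hc
    have h1 := hc i; have h2 := hc j; have h3 := hc p
    grind
  have h1 : ∀ {a b c : Fin k}, a ≠ b → a ≠ c → b ≠ c → B (E F a b) (E F a c) = 0 :=
    fun hab hac hbc => hB.apply_twice_right hab hac (h0 hab hac hbc)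
  by_cases had : a = d
  · subst had; exact h0 hab hcd.symm hbc
  by_cases hbd : b = d
  · subst hbd
    by_cases hac : a = c
    · subst hac
      obtain ⟨q, haq, hbq⟩ := third a b
      have h2 := hB.of_eq_zero (h1 hab haq hbq) hbq.symm
      simp [hab.symm, hbq] at h2
      exact h2
    · exact hB.apply_twice_left hab.symm hbc (h0 hab.symm hbc hac)
  by_cases hac : a = c
  · subst hac; exact h1 hab had hbd
  · have h2 := hB.of_eq_zero (h0 hab hac hbc) had
    simp [Ne.symm had, hab.symm, hcd.symm] at h2
    exact h2

end Factor

section Factor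

variable {F : Type*} [Field F] {k : ℕ} {A : Type*} [AddCommGroup A] [Module F A]
variable {B : Mat F k →ₗ[F] Mat F k →ₗ[F] A}

theorem exists_linearMap_E (n : Fin k → Fin k → A) :
    ∃ N : Mat F k →ₗ[F] A, ∀ i j, N (E F i j) = n i j := by
  refine ⟨(Matrix.stdBasis F (Fin k) (Fin k)).constr F fun p => n p.1 p.2, fun i j => ?_⟩
  have h := Module.Basis.constr_basis (Matrix.stdBasis F (Fin k) (Fin k)) F
    (fun p => n p.1 p.2) (i, j)
  rwa [Matrix.stdBasis_eq_single] at h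

/-- To factor a bilinear map through the product on traceless matrices it suffices to look at the
spanning set of the `e_{ij}` and `e_{ii} - e_{jj}`. -/
theorem factor_of_span {N : Mat F k →ₗ[F] A}
    (h1 : ∀ i j p q, i ≠ j → p ≠ q → B (E F i j) (E F p q) = N (E F i j * E F p q))
    (h2 : ∀ i j p q, i ≠ j → p ≠ q →
      B (E F i i - E F j j) (E F p q) = N ((E F i i - E F j j) * E F p q))
    (h3 : ∀ i j p q, i ≠ j → p ≠ q →
      B (E F i j) (E F p p - E F q q) = N (E F i j * (E F p p - E F q q)))
    (h4 : ∀ i j p q, i ≠ j → p ≠ q → B (E F i i - E F j j) (E F p p - E F q q)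
      = N ((E F i i - E F j j) * (E F p p - E F q q)))
    {a b : Mat F k} (ha : a.trace = 0) (hb : b.trace = 0) : B a b = N (a * b) := by
  have right : ∀ x : Mat F k, (∀ p q, p ≠ q → B x (E F p q) = N (x * E F p q)) →
      (∀ p q, p ≠ q → B x (E F p p - E F q q) = N (x * (E F p p - E F q q))) →
      B x b = N (x * b) := fun x hx hx' =>
    mem_of_trace_eq_zero (S := LinearMap.eqLocus (B x) (N ∘ₗ LinearMap.mulLeft F x)) hx hx' hb
  exact mem_of_trace_eq_zero
    (S := LinearMap.eqLocus (B.flip b) (N ∘ₗ LinearMap.mulRight F b))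
    (fun i j hij => right _ (fun p q => h1 i j p q hij) (fun p q => h3 i j p q hij))
    (fun i j hij => right _ (fun p q => h2 i j p q hij) (fun p q => h4 i j p q hij)) ha

variable (hB : Equivariant B)
include hB

section Large

variable (hz : ∀ a b c d, a ≠ b → c ≠ d → b ≠ c → B (E F a b) (E F c d) = 0)
include hz

/-- The products `e_{pr} e_{rq}` do not depend on `r`. -/
theorem Equivariant.middle {p q r s : Fin k} (hpr : p ≠ r) (hqr : q ≠ r) (hps : p ≠ s)
    (hqs : q ≠ s) : B (E F p r) (E F r q) = B (E F p s) (E F s q) := by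
  by_cases hrs : r = s
  · rw [hrs]
  have h1 := hB.of_eq_zero (hz p r s q hpr hqs.symm hrs) hrs
  simp [hqr, hps.symm] at h1
  linear_combination (norm := module) h1

theorem Equivariant.diag_left {p q r : Fin k} (hpq : p ≠ q) (hpr : p ≠ r) (hqr : q ≠ r) :
    B (E F r r - E F p p) (E F p q) = -B (E F p r) (E F r q) := by
  have h1 := hB.of_eq_zero (hz p r p q hpr hpq hpr.symm) hpr.symm
  simp [hqr] at h1
  simp only [map_sub, LinearMap.sub_apply]
  linear_combination (norm := module) h1

theorem Equivariant.diag_left_zero {p q r s : Fin k} (hpq : p ≠ q) (hpr : p ≠ r) (hps : p ≠ s) :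
    B (E F r r - E F s s) (E F p q) = 0 := by
  have key : ∀ {r s}, p ≠ r → p ≠ s → q ≠ r → B (E F r r - E F s s) (E F p q) = 0 := by
    intro r s hpr hps hqr
    by_cases hrs : r = s
    · simp [hrs]
    have h1 := hB.of_eq_zero (hz s r p q (Ne.symm hrs) hpq hpr.symm) hrs
    simpa [E_mul, hpr, hqr, hps, hps.symm] using h1
  by_cases hqr : q = r
  · by_cases hqs : q = s
    · simp [← hqr, ← hqs]
    have := key hps hpr hqs
    rw [← neg_sub, map_neg, LinearMap.neg_apply, this, neg_zero]
  · exact key hpr hps hqr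

theorem Equivariant.diag_right {p r s : Fin k} (hpr : p ≠ r) (hps : p ≠ s) (hrs : r ≠ s) :
    B (E F p r) (E F r r - E F s s) = B (E F p s) (E F s r) := by
  have h1 := hB.of_eq_zero (hz p r s r hpr hrs.symm hrs) hrs
  simp [hps.symm] at h1
  simp only [map_sub]
  linear_combination (norm := module) h1

theorem Equivariant.diag_right_zero {p q r s : Fin k} (hpq : p ≠ q) (hqr : q ≠ r)
    (hqs : q ≠ s) : B (E F p q) (E F r r - E F s s) = 0 := by
  have key : ∀ {r s}, q ≠ r → q ≠ s → p ≠ s → B (E F p q) (E F r r - E F s s) = 0 := by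
    intro r s hqr hqs hps
    by_cases hrs : r = s
    · simp [hrs]
    have h1 := hB.of_eq_zero (hz p q s r hpq (Ne.symm hrs) hqs) hrs
    simpa [E_mul, hqr, hqs, hps, hps.symm] using h1
  by_cases hps : p = s
  · by_cases hpr : p = r
    · simp [← hpr, ← hps]
    have := key hqs hqr hpr
    rw [← neg_sub, map_neg, this, neg_zero]
  · exact key hqr hqs hps

theorem Equivariant.diag_diag {p q r : Fin k} (hpq : p ≠ q) (hpr : p ≠ r) (hqr : q ≠ r) :
    B (E F r r - E F p p) (E F q q - E F p p) = B (E F p r) (E F r p) := by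
  have h1 := hB.of_eq_neg (hB.diag_left hz hpq hpr hqr) hpq.symm
  have h2 := hB.middle hz (p := q) (q := q) hqr hqr hpq.symm hpq.symm
  simp [mul_sub, sub_mul, hpq, hpr, hqr.symm] at h1
  simp only [map_sub, LinearMap.sub_apply]
  linear_combination (norm := module) h1 - h2

/-- For `k ≥ 3` an equivariant bilinear map that kills the pairs of off-diagonal matrix units with
product `0` depends only on the product of its two arguments. -/
theorem Equivariant.factor_large (third : ∀ a b : Fin k, ∃ c, a ≠ c ∧ b ≠ c) :
    ∃ N : Mat F k →ₗ[F] A, ∀ a b, a.trace = 0 → b.trace = 0 → B a b = N (a * b) := by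
  choose r hr1 hr2 using third
  obtain ⟨N, hN⟩ := exists_linearMap_E (F := F) fun p q => B (E F p (r p q)) (E F (r p q) q)
  have hmid : ∀ {p q s}, p ≠ s → q ≠ s → B (E F p s) (E F s q) = N (E F p q) :=
    fun hps hqs => by rw [hN]; exact hB.middle hz hps hqs (hr1 _ _) (hr2 _ _)
  have L1 : ∀ {p q s : Fin k}, p ≠ q → p ≠ s →
      B (E F s s - E F p p) (E F p q) = -N (E F p q) := by
    intro p q s hpq hps
    have h1 : B (E F (r p q) (r p q) - E F p p) (E F p q) = -N (E F p q) := by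
      rw [hB.diag_left hz hpq (hr1 p q) (hr2 p q), hmid (hr1 p q) (hr2 p q)]
    have h2 := hB.diag_left_zero hz hpq hps (hr1 p q)
    rw [← h1, ← sub_eq_zero, ← h2]
    simp only [map_sub, LinearMap.sub_apply]
    abel
  have R1 : ∀ {p q s : Fin k}, p ≠ q → q ≠ s →
      B (E F p q) (E F q q - E F s s) = N (E F p q) := by
    intro p q s hpq hps
    have h1 : B (E F p q) (E F q q - E F (r p q) (r p q)) = N (E F p q) := by
      rw [hB.diag_right hz hpq (hr1 p q) (hr2 p q), hmid (hr1 p q) (hr2 p q)]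
    have h2 := hB.diag_right_zero hz hpq (hr2 p q) hps
    rw [← h1, ← sub_eq_zero, ← h2]
    simp only [map_sub]
    abel
  -- the values on pairs of diagonal matrices with a common negative entry
  have D1 : ∀ {p q s : Fin k}, p ≠ q → B (E F s s - E F p p) (E F q q - E F p p)
      = N ((E F s s - E F p p) * (E F q q - E F p p)) := by
    intro p q s hpq
    have D0 : ∀ {p q s : Fin k}, p ≠ q → p ≠ s → q ≠ s →
        B (E F s s - E F p p) (E F q q - E F p p) = N (E F p p) := fun hpq hps hqs => by
      rw [hB.diag_diag hz hpq hps hqs, hmid hps hps]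
    by_cases hps : p = s
    · simp [hps]
    by_cases hqs : q = s
    · subst hqs
      have h1 := D0 hpq (hr1 p q) (hr2 p q)
      have h2 := D0 hpq.symm (hr2 p q) (hr1 p q)
      simp [mul_sub, sub_mul, hpq, hpq.symm] at h1 h2 ⊢
      linear_combination (norm := module) h1 + h2
    · rw [D0 hpq hps hqs]
      simp [mul_sub, sub_mul, hpq, Ne.symm hps, Ne.symm hqs]
  refine ⟨N, fun a b ha hb => factor_of_span ?_ ?_ ?_ ?_ ha hb⟩
  · intro i j p q hij hpq
    rw [E_mul]
    split_ifs with h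
    · subst h; exact hmid hij hpq.symm
    · rw [hz i j p q hij hpq h, map_zero]
  · intro i j p q hij hpq
    by_cases hpi : p = i
    · subst hpi
      have h1 := L1 hpq hij
      simp [sub_mul, hij.symm] at h1 ⊢
      linear_combination (norm := module) -h1
    by_cases hpj : p = j
    · subst hpj
      rw [L1 hpq hpi]
      simp [sub_mul, hij]
    · rw [hB.diag_left_zero hz hpq hpi hpj]
      simp [sub_mul, Ne.symm hpi, Ne.symm hpj]
  · intro i j p q hij hpq
    by_cases hjp : j = p
    · subst hjp
      rw [R1 hij hpq]
      simp [mul_sub, hpq]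
    by_cases hjq : j = q
    · subst hjq
      have h1 := R1 hij hjp
      simp [mul_sub, hjp] at h1 ⊢
      linear_combination (norm := module) -h1
    · rw [hB.diag_right_zero hz hij hjp hjq]
      simp [mul_sub, hjp, hjq]
  · intro i j p q hij hpq
    have h1 := D1 (s := i) hpq.symm
    have h2 := D1 (s := j) hpq.symm
    have : E F i i - E F j j = (E F i i - E F q q) - (E F j j - E F q q) := by abel
    rw [this, sub_mul, map_sub B, map_sub N, LinearMap.sub_apply, h1, h2]

end Large

/-- For `k = 2` an equivariant bilinear map that kills `(e_{12}, e_{12})` depends only on the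
product of its two arguments: the kernel of the product on `sl_2 ⊗ sl_2` is irreducible. -/
theorem Equivariant.factor_two [CharZero F] {i j : Fin k} (hij : i ≠ j)
    (hall : ∀ p, p = i ∨ p = j) (h : B (E F i j) (E F i j) = 0) :
    ∃ N : Mat F k →ₗ[F] A, ∀ a b, a.trace = 0 → b.trace = 0 → B a b = N (a * b) := by
  have e1 : B (E F i i - E F j j) (E F i j) = -B (E F i j) (E F i i - E F j j) := by
    have := hB.of_eq_zero h hij.symm
    simp at this
    simp only [map_sub, LinearMap.sub_apply]
    linear_combination (norm := module) -this
  have e2 : B (E F i i - E F j j) (E F i i - E F j j)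
      = B (E F i j) (E F j i) + B (E F j i) (E F i j) := by
    have := hB.of_eq_neg e1 hij.symm
    simp [mul_sub, sub_mul, hij] at this
    simp only [map_sub, LinearMap.sub_apply]
    linear_combination (norm := module) (-(2 : F)⁻¹) • this
  have e3 : B (E F i i - E F j j) (E F j i) = -B (E F j i) (E F i i - E F j j) := by
    obtain ⟨D, hD⟩ := hB j i hij.symm
    have := congrArg D e2
    rw [map_add, hD, hD, hD] at this
    simp [mul_sub, sub_mul, hij] at this
    simp only [map_sub, LinearMap.sub_apply]
    linear_combination (norm := module) ((3 : F)⁻¹) • this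
  have e4 : B (E F j i) (E F j i) = 0 := by
    have := hB.of_eq_neg e3 hij.symm
    simp [mul_sub, sub_mul, hij] at this
    linear_combination (norm := module) ((4 : F)⁻¹) • this
  obtain ⟨N, hN⟩ := exists_linearMap_E (F := F) fun p q =>
    if p = i then (if q = i then B (E F i j) (E F j i) else B (E F i i - E F j j) (E F i j))
    else (if q = i then B (E F j i) (E F i i - E F j j) else B (E F j i) (E F i j))
  have n1 : N (E F i i) = B (E F i j) (E F j i) := by simp [hN]
  have n2 : N (E F j j) = B (E F j i) (E F i j) := by simp [hN, hij.symm]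
  have n3 : N (E F i j) = B (E F i i - E F j j) (E F i j) := by rw [hN]; simp [hij.symm]
  have n4 : N (E F j i) = B (E F j i) (E F i i - E F j j) := by rw [hN]; simp [hij.symm]
  have m1 : (E F i i - E F j j) * E F i j = E F i j := by simp [sub_mul, hij.symm]
  have m2 : (E F i i - E F j j) * E F j i = -E F j i := by simp [sub_mul, hij]
  have m3 : E F i j * (E F i i - E F j j) = -E F i j := by simp [mul_sub, hij.symm]
  have m4 : E F j i * (E F i i - E F j j) = E F j i := by simp [mul_sub, hij]
  have m5 : (E F i i - E F j j) * (E F i i - E F j j) = E F i i + E F j j := by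
    simp [mul_sub, sub_mul, hij, hij.symm]
  have m6 : E F j j - E F i i = -(E F i i - E F j j) := by abel
  have pair : ∀ a b : Fin k, a ≠ b → (a = i ∧ b = j) ∨ (a = j ∧ b = i) := by
    intro a b hab
    have h1 := hall a
    have h2 := hall b
    grind
  rw [← n1, ← n2] at e2
  rw [← n3] at e1
  rw [← n4] at e3
  have e1' : B (E F i j) (E F i i - E F j j) = -N (E F i j) := by rw [e1, neg_neg]
  have o1 : E F i j * E F i j = 0 := by simp [hij.symm]
  have o2 : E F j i * E F j i = 0 := by simp [hij]
  have o3 : E F i j * E F j i = E F i i := by simp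
  have o4 : E F j i * E F i j = E F j j := by simp
  refine ⟨N, fun a b ha hb => factor_of_span ?_ ?_ ?_ ?_ ha hb⟩
  all_goals
    intro a b c d hab hcd
    rcases pair a b hab with ⟨h1, h2⟩ | ⟨h1, h2⟩ <;>
    rcases pair c d hcd with ⟨h3, h4⟩ | ⟨h3, h4⟩ <;>
    simp only [h1, h2, h3, h4, m6, map_neg, LinearMap.neg_apply, neg_mul, mul_neg, m1, m2, m3, m4,
      m5, o1, o2, o3, o4, e1', e2, e3, e4, h, n1, n2, ← n3, ← n4, map_zero, map_add, neg_neg]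

end Factor

section Products

variable {F : Type*} [Field F] {k : ℕ}

/-- The products of two traceless matrices span `M_k(F)`. -/
theorem linearMap_ext_mul {N : Type*} [AddCommGroup N] [Module F N] (hk : 2 ≤ k)
    {f g : Mat F k →ₗ[F] N}
    (h : ∀ a b : Mat F k, a.trace = 0 → b.trace = 0 → f (a * b) = g (a * b)) : f = g := by
  refine mat_ext fun i j => ?_
  by_cases hij : i = j
  · subst hij
    have : Nontrivial (Fin k) := Fin.nontrivial_iff_two_le.2 hk
    obtain ⟨j, hj⟩ := exists_ne i
    have := h (E F i j) (E F j i) (by simp [hj.symm]) (by simp [hj])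
    simpa [E_mul] using this
  · have := h (E F i i - E F j j) (E F i j) (by simp) (by simp [hij])
    simpa [sub_mul, E_mul, Ne.symm hij] using this

/-- If an equivariant bilinear map factors through the product and kills `(e_{ij}, e_{ji})`, then
it is zero, because `e_{ii}` generates the `sl_k`-module `M_k(F)`. -/
theorem Equivariant.eq_zero_of_factor {A : Type*} [AddCommGroup A] [Module F A] (hk : 2 ≤ k)
    {B : Mat F k →ₗ[F] Mat F k →ₗ[F] A} (hB : Equivariant B) {N : Mat F k →ₗ[F] A}
    (hN : ∀ a b, a.trace = 0 → b.trace = 0 → B a b = N (a * b)) {i j : Fin k} (hij : i ≠ j)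
    (h : B (E F i j) (E F j i) = 0) : N = 0 := by
  have hii : N (E F i i) = 0 := by
    rw [hN _ _ (by simp [hij]) (by simp [hij.symm])] at h
    simpa [E_mul] using h
  have htr : ∀ x y : Mat F k, (x * y - y * x).trace = 0 := fun x y => by
    rw [Matrix.trace_sub, Matrix.trace_mul_comm, sub_self]
  have hst : LinearMap.ker N = ⊤ := by
    refine eq_top_of_stable (fun p q hpq m hm => ?_) hii
    obtain ⟨D, hD⟩ := hB p q hpq
    have : D ∘ₗ N = N ∘ₗ (LinearMap.mulLeft F (E F p q) - LinearMap.mulRight F (E F p q)) := by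
      refine linearMap_ext_mul hk fun a b ha hb => ?_
      rw [LinearMap.comp_apply, ← hN a b ha hb, hD, hN _ _ (htr _ _) hb, hN _ _ ha (htr _ _),
        ← map_add]
      simp only [LinearMap.comp_apply, LinearMap.sub_apply, LinearMap.mulLeft_apply,
        LinearMap.mulRight_apply]
      congr 1
      noncomm_ring
    have h2 := DFunLike.congr_fun this m
    simp only [LinearMap.comp_apply, LinearMap.sub_apply, LinearMap.mulLeft_apply,
        LinearMap.mulRight_apply] at h2
    rw [LinearMap.mem_ker] at hm ⊢
    rw [← h2, hm, map_zero]
  exact LinearMap.ker_eq_top.1 hst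

end Products

/-! ### Normal form of words in traceless matrices -/

section NormalForm

variable {F : Type*} [Field F] {k : ℕ} {A : Type*} [Ring A] [Algebra F A]

/-- Degree three: if `w₁ a * w₂ b` and `w₂ a * w₃ b` depend only on `a * b`, then
`w₁ a * w₂ b * w₃ c` depends only on `a * b * c`. -/
theorem mul_of_factor {w₁ w₂ w₃ N₁₂ N₂₃ : Mat F k →ₗ[F] A}
    (h₁ : ∀ a b, a.trace = 0 → b.trace = 0 → w₁ a * w₂ b = N₁₂ (a * b))
    (h₂ : ∀ a b, a.trace = 0 → b.trace = 0 → w₂ a * w₃ b = N₂₃ (a * b))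
    {s s' : Mat F k} (hs : s.trace = 0) (hss : s * s' = 1) {i j : Fin k} (hij : i ≠ j)
    (hs1 : s' j i = 0) (hs2 : s' i i ≠ 0) (m : Mat F k) {d : Mat F k} (hd : d.trace = 0) :
    N₁₂ m * w₃ d = w₁ s * N₂₃ (s' * (m * d)) := by
  -- insert the letter `s`: if `s' m` is traceless, then `N₁₂ m = w₁ s * w₂ (s' m)`
  have fact1 : ∀ m d : Mat F k, (s' * m).trace = 0 → d.trace = 0 →
      N₁₂ m * w₃ d = w₁ s * N₂₃ (s' * (m * d)) := by
    intro m d hm hd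
    rw [← mul_assoc s', ← h₂ _ _ hm hd, ← mul_assoc, h₁ _ _ hs hm, ← mul_assoc, hss, one_mul]
  have htE : ∀ p q, (s' * E F p q).trace = s' q p := by
    intro p q
    rw [Matrix.trace_mul_single]
    simp
  have t1 : (E F i j).trace = 0 := by simp [hij]
  have t2 : (E F j i).trace = 0 := by simp [hij.symm]
  have t3 : (E F j j - E F i i).trace = 0 := by simp
  have fact2 : ∀ q, w₁ (E F i j) * N₂₃ (E F j q) = w₁ s * N₂₃ (s' * E F i q) := by
    intro q
    by_cases hq : q = j
    · subst hq
      -- `e_{jj} = h² - e_{ij} e_{ji}` with `h = e_{jj} - e_{ii}`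
      have e1 : E F q q = (E F q q - E F i i) * (E F q q - E F i i) - E F i q * E F q i := by
        simp [mul_sub, sub_mul, hij, hij.symm]
      have e2 : E F i q * (E F q q - E F i i) = E F i q := by simp [mul_sub, hij.symm]
      have e3 : E F i q * E F i q = 0 := by simp [hij.symm]
      rw [e1, map_sub, ← h₂ _ _ t3 t3, ← h₂ _ _ t1 t2, mul_sub, ← mul_assoc, ← mul_assoc,
        h₁ _ _ t1 t3, h₁ _ _ t1 t1, e2, e3, map_zero, zero_mul, sub_zero,
        fact1 _ _ (by rw [htE, hs1]) t3, e2]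
    · have e1 : E F j q = (E F j j - E F i i) * E F j q := by simp [sub_mul, hij]
      have e2 : E F i j * (E F j j - E F i i) = E F i j := by simp [mul_sub, hij.symm]
      have t4 : (E F j q).trace = 0 := by simp [Ne.symm hq]
      rw [e1, ← h₂ _ _ t3 t4, ← mul_assoc, h₁ _ _ t1 t3, e2, fact1 _ _ (by rw [htE, hs1]) t4]
      simp
  -- `e_{ii}` is not covered by `fact1`, but it is the product of `e_{ij}` and `e_{ji}`
  have fact3 : ∀ d : Mat F k, d.trace = 0 →
      N₁₂ (E F i i) * w₃ d = w₁ s * N₂₃ (s' * (E F i i * d)) := by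
    intro d hd
    have e1 : E F i i = E F i j * E F j i := by simp
    rw [e1, ← h₁ _ _ t1 t2, mul_assoc, h₂ _ _ t2 hd, ← e1]
    have : LinearMap.mulLeft F (w₁ (E F i j)) ∘ₗ N₂₃ ∘ₗ LinearMap.mulLeft F (E F j i)
        = LinearMap.mulLeft F (w₁ s) ∘ₗ N₂₃ ∘ₗ LinearMap.mulLeft F s' ∘ₗ
          LinearMap.mulLeft F (E F i i) := by
      refine mat_ext fun p q => ?_
      simp only [LinearMap.comp_apply, LinearMap.mulLeft_apply, E_mul]
      split_ifs with h
      · exact fact2 q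
      · simp
    exact DFunLike.congr_fun this d
  have hm : m = (m - ((s' * m).trace / s' i i) • E F i i)
      + ((s' * m).trace / s' i i) • E F i i := by abel
  have hm0 : (s' * (m - ((s' * m).trace / s' i i) • E F i i)).trace = 0 := by
    rw [mul_sub, Matrix.trace_sub, mul_smul_comm, Matrix.trace_smul, htE, smul_eq_mul,
      div_mul_cancel₀ _ hs2, sub_self]
  rw [hm, map_add, add_mul, fact1 _ _ hm0 hd, map_smul, smul_mul_assoc, fact3 d hd, add_mul,
    mul_add, map_add, mul_add, smul_mul_assoc, mul_smul_comm, map_smul, mul_smul_comm]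

/-- An invertible traceless matrix, used as the standard letter of normal words. -/
theorem exists_traceless_unit [CharZero F] (hk : 2 ≤ k) :
    ∃ s s' : Mat F k, s.trace = 0 ∧ s * s' = 1 ∧ ∃ i j, i ≠ j ∧ s' j i = 0 ∧ s' i i ≠ 0 := by
  let i : Fin k := ⟨0, by omega⟩
  let j : Fin k := ⟨1, by omega⟩
  have hij : i ≠ j := by simp [i, j]
  have hk1 : (1 - (k : F)) ≠ 0 := by
    rw [sub_ne_zero]
    exact_mod_cast (by omega : 1 ≠ k)
  refine ⟨1 - (k : F) • E F i i, 1 + ((k : F) / (1 - k)) • E F i i, ?_, ?_, i, j, hij, ?_, ?_⟩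
  · simp
  · simp only [sub_mul, mul_add, one_mul, mul_one, smul_mul_smul_comm, E_mul, if_true]
    have : ((k : F) / (1 - k)) = k + k * (k / (1 - k)) := by field_simp; ring
    nth_rw 1 [this]
    module
  · simp [hij, hij.symm]
  · simp
    field_simp
    simp

variable {τ : Type*} (w : τ → Mat F k →ₗ[F] A) (N₂ : τ → τ → Mat F k →ₗ[F] A) (s s' : Mat F k)

/-- The word `w t₁ b₁ * ⋯ * w tₙ bₙ` in traceless matrices `bᵢ`, as a function of the list of the
`tᵢ` and of the product `b₁ ⋯ bₙ`. For `n ≥ 3` all but the last two letters are normalized to the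
invertible matrix `s`, with inverse `s'`. -/
noncomputable def normalWord : List τ → (Mat F k →ₗ[F] A)
  | [] => ((k : F)⁻¹ • Matrix.traceLinearMap (Fin k) F F).smulRight 1
  | [t] => w t
  | [t, u] => N₂ t u
  | t :: u :: v :: l =>
      LinearMap.mulLeft F (w t s) ∘ₗ normalWord (u :: v :: l) ∘ₗ LinearMap.mulLeft F s'

theorem normalWord_cons (t : τ) (l : List τ) (hl : 2 ≤ l.length) (m : Mat F k) :
    normalWord w N₂ s s' (t :: l) m = w t s * normalWord w N₂ s s' l (s' * m) := by
  match l, hl with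
  | u :: v :: l, _ => rfl

variable {w N₂ s s'}
variable (hN : ∀ t u a b, a.trace = 0 → b.trace = 0 → w t a * w u b = N₂ t u (a * b))
  (hsymm : ∀ t u, N₂ t u = N₂ u t) (hs : s.trace = 0) (hss : s * s' = 1) {i j : Fin k} (hij : i ≠ j)
  (hs1 : s' j i = 0) (hs2 : s' i i ≠ 0) (hk0 : (k : F) ≠ 0) (hk : 2 ≤ k)
include hN hs hss hij hs1 hs2 hk0

theorem normalWord_append (l : List τ) (t : τ) (m c : Mat F k) (hc : c.trace = 0)
    (hm0 : l.length = 0 → ∃ r : F, m = r • 1) (hm1 : l.length = 1 → m.trace = 0) :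
    normalWord w N₂ s s' (l ++ [t]) (m * c) = normalWord w N₂ s s' l m * w t c := by
  match l with
  | [] =>
    obtain ⟨r, rfl⟩ := hm0 rfl
    simp [normalWord, hk0]
  | [a] => exact (hN a t m c (hm1 rfl) hc).symm
  | [a, b] =>
    exact (mul_of_factor (hN a b) (hN b t) hs hss hij hs1 hs2 m hc).symm
  | a :: b :: u :: l =>
    rw [List.cons_append, normalWord_cons _ _ _ _ _ _ (by simp),
      normalWord_cons _ _ _ _ _ _ (by simp), ← mul_assoc,
      normalWord_append (b :: u :: l) t (s' * m) c hc (by simp) (by simp), mul_assoc]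

include hsymm hk

theorem normalWord_perm {l l' : List τ} (h : l.Perm l') :
    normalWord w N₂ s s' l = normalWord w N₂ s s' l' := by
  induction h with
  | nil => rfl
  | trans _ _ h₁ h₂ => rw [h₁, h₂]
  | @cons t l l' h ih =>
    match l, l', h.length_eq, h with
    | [], [], _, _ => rfl
    | [a], [b], _, h =>
      have := List.perm_singleton.1 h
      rw [this]
    | a :: b :: l, a' :: b' :: l', _, h =>
      ext1 m
      rw [normalWord_cons _ _ _ _ t (a :: b :: l) (by simp),
        normalWord_cons _ _ _ _ t (a' :: b' :: l') (by simp), ih]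
  | swap t u l =>
    match l with
    | [] => exact hsymm u t
    | [a] =>
      refine linearMap_ext_mul hk fun m c _ hc => ?_
      have h1 := normalWord_append hN hs hss hij hs1 hs2 hk0 [u, t] a m c hc (by simp) (by simp)
      have h2 := normalWord_append hN hs hss hij hs1 hs2 hk0 [t, u] a m c hc (by simp) (by simp)
      have h3 : normalWord w N₂ s s' [u, t] = normalWord w N₂ s s' [t, u] := hsymm u t
      rw [h3] at h1
      exact h1.trans h2.symm
    | a :: b :: l =>
      ext1 m
      rw [normalWord_cons _ _ _ _ u (t :: a :: b :: l) (by simp),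
        normalWord_cons _ _ _ _ t (a :: b :: l) (by simp),
        normalWord_cons _ _ _ _ t (u :: a :: b :: l) (by simp),
        normalWord_cons _ _ _ _ u (a :: b :: l) (by simp),
        ← mul_assoc (w u s), ← mul_assoc (w t s), hN _ _ _ _ hs hs, hN _ _ _ _ hs hs, hsymm]

end NormalForm

section Mixed

variable {F : Type*} [Field F] {k : ℕ} {A : Type*} [Ring A] [Algebra F A]
  {τ : Type*} (p : τ → Prop) [DecidablePred p]

/-- The matrices that occur as products of letters of types `μ`: a letter of a type with `p` is a
scalar matrix, the other letters are traceless. -/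
def Occurs (μ : Multiset τ) (m : Mat F k) : Prop :=
  ((μ.filter fun t => ¬ p t).card = 0 → ∃ r : F, m = r • 1) ∧
    ((μ.filter fun t => ¬ p t).card = 1 → m.trace = 0)

variable {p}

theorem Occurs.cons_scalar {μ : Multiset τ} {m : Mat F k} (h : Occurs p μ m) {t : τ} (ht : p t)
    (r : F) : Occurs p (t ::ₘ μ) (m * r • 1) := by
  simp only [Occurs, Multiset.filter_cons_of_neg μ (p := fun t => ¬ p t) (not_not.2 ht)]
  refine ⟨fun h0 => ?_, fun h1 => ?_⟩
  · obtain ⟨r', rfl⟩ := h.1 h0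
    exact ⟨r' * r, by simp [smul_smul, mul_comm]⟩
  · simp [h.2 h1]

theorem Occurs.cons_traceless {μ : Multiset τ} {m : Mat F k} (h : Occurs p μ m) {t : τ}
    (ht : ¬ p t) {c : Mat F k} (hc : c.trace = 0) : Occurs p (t ::ₘ μ) (m * c) := by
  simp only [Occurs, Multiset.filter_cons_of_pos μ (p := fun t => ¬ p t) ht, Multiset.card_cons]
  refine ⟨fun h0 => by omega, fun h1 => ?_⟩
  obtain ⟨r, rfl⟩ := h.1 (by omega)
  simp [hc]

/-- The normal form of words that contain central letters besides the traceless ones: such a word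
depends only on the multiset of the types of its letters and on a product of matrices. -/
theorem exists_normalForm [CharZero F] (hk : 2 ≤ k) (w : τ → Mat F k →ₗ[F] A) (z : τ → A)
    (hN : ∀ t u, ∃ N : Mat F k →ₗ[F] A, ∀ a b, a.trace = 0 → b.trace = 0 →
      w t a * w u b = N (a * b) ∧ w u a * w t b = N (a * b))
    (hz : ∀ t a, p t → z t * a = a * z t) :
    ∃ S : Multiset τ → (Mat F k →ₗ[F] A), S 0 1 = 1 ∧
      (∀ μ m t, p t → S (t ::ₘ μ) m = S μ m * z t) ∧
      ∀ μ m t c, ¬ p t → Occurs p μ m → c.trace = 0 → S (t ::ₘ μ) (m * c) = S μ m * w t c := by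
  choose N₂ hN₂ using hN
  have hk0 : (k : F) ≠ 0 := Nat.cast_ne_zero.2 (by omega)
  have hsymm : ∀ t u, N₂ t u = N₂ u t := fun t u => linearMap_ext_mul hk fun a b ha hb => by
    rw [← (hN₂ t u a b ha hb).1, (hN₂ u t a b ha hb).2]
  obtain ⟨s, s', hs, hss, i, j, hij, hs1, hs2⟩ := exists_traceless_unit (F := F) hk
  have hN' : ∀ t u a b, a.trace = 0 → b.trace = 0 → w t a * w u b = N₂ t u (a * b) :=
    fun t u a b ha hb => (hN₂ t u a b ha hb).1
  -- the central letters first, then the others in normal form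
  let T : List τ → (Mat F k →ₗ[F] A) := fun l =>
    LinearMap.mulLeft F ((l.filter p).map z).prod ∘ₗ
      normalWord w N₂ s s' (l.filter fun t => ¬ p t)
  have hT : ∀ l l' : List τ, l.Perm l' → T l = T l' := by
    intro l l' h
    have h1 : ((l.filter p).map z).prod = ((l'.filter p).map z).prod := by
      refine List.Perm.prod_eq' ((h.filter _).map z) ?_
      rw [List.pairwise_map]
      refine List.pairwise_of_forall_mem_list fun a ha b _ => ?_
      exact hz a _ (by simpa using List.of_mem_filter ha)
    simp only [T]
    rw [h1, normalWord_perm hN' hsymm hs hss hij hs1 hs2 hk0 hk (h.filter _)]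
  refine ⟨fun μ => Quotient.liftOn μ T hT, ?_, ?_, ?_⟩
  · change T [] 1 = 1
    simp [T, normalWord, hk0]
  · intro μ m t ht
    induction μ using Quotient.inductionOn with | _ l
    change T (t :: l) m = T l m * z t
    simp only [T, List.filter_cons_of_pos (p := fun t => decide (p t)) (by simpa using ht),
      List.filter_cons_of_neg (p := fun t => decide (¬ p t)) (a := t) (by simpa using ht),
      List.map_cons, List.prod_cons, LinearMap.comp_apply, LinearMap.mulLeft_apply]
    rw [mul_assoc, hz t _ ht]
  · intro μ m t c ht hm hc
    induction μ using Quotient.inductionOn with | _ l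
    have h1 : Quotient.liftOn (t ::ₘ (⟦l⟧ : Multiset τ)) T hT = T (l ++ [t]) :=
      hT _ _ (List.perm_append_singleton t l).symm
    change Quotient.liftOn (t ::ₘ (⟦l⟧ : Multiset τ)) T hT _ = T l m * w t c
    rw [h1]
    have h2 : (l ++ [t]).filter (fun t => decide (p t)) = l.filter fun t => decide (p t) := by
      simp [List.filter_append, ht]
    have h3 : (l ++ [t]).filter (fun t => decide (¬ p t))
        = l.filter (fun t => decide (¬ p t)) ++ [t] := by
      simp [List.filter_append, ht]
    simp only [T, h2, h3, LinearMap.comp_apply, LinearMap.mulLeft_apply]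
    rw [normalWord_append hN' hs hss hij hs1 hs2 hk0 _ t m c hc, mul_assoc]
    · intro h; exact hm.1 (by simpa using h)
    · intro h; exact hm.2 (by simpa using h)

end Mixed

/-! ### Universal enveloping algebras and free algebras with exponents -/

section Enveloping

attribute [local instance 100] LieRing.ofAssociativeRing

variable {F L' P Q : Type*} [Field F] [LieRing L'] [LieAlgebra F L'] [AddCommGroup P] [Module F P]
  [AddCommGroup Q] [Module F Q]

theorem envelopingAlgebra_subalgebra_eq_top {S : Subalgebra F (UniversalEnvelopingAlgebra F L')}
    (h : ∀ x, UniversalEnvelopingAlgebra.ι F x ∈ S) : S = ⊤ := by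
  let j : L' →ₗ⁅F⁆ S :=
    { toFun := fun x => ⟨UniversalEnvelopingAlgebra.ι F x, h x⟩
      map_add' := fun x y => Subtype.ext (map_add _ _ _)
      map_smul' := fun r x => Subtype.ext (map_smul _ _ _)
      map_lie' := fun {x y} => Subtype.ext (LieHom.map_lie _ _ _) }
  have h1 : S.val.comp (UniversalEnvelopingAlgebra.lift F j) = AlgHom.id F _ := by
    apply UniversalEnvelopingAlgebra.hom_ext
    ext x
    simp [j]
  rw [eq_top_iff]
  intro v _
  have h2 := DFunLike.congr_fun h1 v
  rw [AlgHom.id_apply] at h2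
  rw [← h2]
  exact (UniversalEnvelopingAlgebra.lift F j v).2

/-- A linear map that commutes with the action of a Lie algebra commutes with the action of its
universal enveloping algebra. -/
theorem envelopingAlgebra_intertwine
    (α : UniversalEnvelopingAlgebra F L' →ₐ[F] Module.End F P)
    (β : UniversalEnvelopingAlgebra F L' →ₐ[F] Module.End F Q) (T : P →ₗ[F] Q)
    (h : ∀ x p, T (α (UniversalEnvelopingAlgebra.ι F x) p)
      = β (UniversalEnvelopingAlgebra.ι F x) (T p)) (v : UniversalEnvelopingAlgebra F L') (p : P) :
    T (α v p) = β v (T p) := by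
  let S : Subalgebra F (UniversalEnvelopingAlgebra F L') :=
    { carrier := {v | ∀ p, T (α v p) = β v (T p)}
      mul_mem' := fun {a b} ha hb p => by
        rw [map_mul, map_mul, Module.End.mul_apply, Module.End.mul_apply, ha, hb]
      add_mem' := fun {a b} ha hb p => by
        rw [map_add, map_add, LinearMap.add_apply, LinearMap.add_apply, map_add, ha, hb]
      algebraMap_mem' := fun r p => by
        rw [AlgHom.commutes, AlgHom.commutes, Module.algebraMap_end_apply,
          Module.algebraMap_end_apply, map_smul] }
  have hS : S = ⊤ := envelopingAlgebra_subalgebra_eq_top h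
  have hv : v ∈ S := hS ▸ Algebra.mem_top
  exact hv p

end Enveloping

section FreeExp

variable {F A : Type*} [Field F] [Ring A] [Algebra F A]

/-- The inclusion of the free algebra with exponents into the tensor algebra. -/
noncomputable def valLin : FreeExp F A →ₗ[F] TensorAlgebra F (ℕ →₀ A) :=
  (augIdeal F (ℕ →₀ A)).toSubmodule.subtype

theorem valLin_injective : Function.Injective (valLin (F := F) (A := A)) :=
  Subtype.val_injective

theorem valLin_mul (f g : FreeExp F A) : valLin (f * g) = valLin f * valLin g := rfl

theorem valLin_xpow (i : ℕ) (u : A) :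
    valLin (F := F) (xpow i u) = TensorAlgebra.ι F (Finsupp.single i u) := rfl

theorem xpow_add (i : ℕ) (u v : A) :
    (xpow i (u + v) : FreeExp F A) = xpow i u + xpow i v :=
  valLin_injective (by simp [valLin_xpow])

theorem xpow_smul (r : F) (i : ℕ) (u : A) :
    (xpow i (r • u) : FreeExp F A) = r • xpow i u :=
  valLin_injective (by rw [map_smul, valLin_xpow, valLin_xpow, ← Finsupp.smul_single, map_smul])

/-- A subspace closed under multiplication that contains the `x_i^u` contains the terms without
constant coefficient of all elements of the tensor algebra. -/
theorem sub_algebraMap_mem {S : Submodule F (FreeExp F A)}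
    (hmul : ∀ f ∈ S, ∀ g ∈ S, f * g ∈ S) (hx : ∀ i u, xpow i u ∈ S)
    (t : TensorAlgebra F (ℕ →₀ A)) :
    t - algebraMap F _ (TensorAlgebra.algebraMapInv t) ∈ S.map valLin := by
  induction t using TensorAlgebra.induction with
  | algebraMap r => simp
  | ι v =>
    have : TensorAlgebra.algebraMapInv (TensorAlgebra.ι F v) = 0 := ι_mem_augIdeal v
    rw [this, map_zero, sub_zero]
    induction v using Finsupp.induction_linear with
    | zero => simp
    | add f g hf hg =>
      rw [map_add]
      exact Submodule.add_mem _ (hf (ι_mem_augIdeal f)) (hg (ι_mem_augIdeal g))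
    | single i u => exact ⟨_, hx i u, rfl⟩
  | mul a b ha hb =>
    obtain ⟨f, hf, hfa⟩ := ha
    obtain ⟨g, hg, hgb⟩ := hb
    refine ⟨f * g + (TensorAlgebra.algebraMapInv a • g + TensorAlgebra.algebraMapInv b • f),
      S.add_mem (hmul f hf g hg) (S.add_mem (S.smul_mem _ hg) (S.smul_mem _ hf)), ?_⟩
    simp only [map_add, valLin_mul, map_smul, hfa, hgb, map_mul, Algebra.smul_def]
    rw [Algebra.commutes (TensorAlgebra.algebraMapInv b)]
    noncomm_ring
  | add a b ha hb =>
    have := Submodule.add_mem _ ha hb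
    rw [map_add, map_add, add_sub_add_comm]
    exact this

theorem freeExp_mem {S : Submodule F (FreeExp F A)}
    (hmul : ∀ f ∈ S, ∀ g ∈ S, f * g ∈ S) (hx : ∀ i u, xpow i u ∈ S) (f : FreeExp F A) : f ∈ S := by
  obtain ⟨g, hg, hgf⟩ := sub_algebraMap_mem hmul hx (valLin f)
  have : TensorAlgebra.algebraMapInv (valLin f) = 0 := f.2
  rw [this, map_zero, sub_zero] at hgf
  rwa [← valLin_injective hgf]

theorem freeExp_hom_ext {B : Type*} [NonUnitalRing B] [Module F B] {φ ψ : FreeExp F A →ₙₐ[F] B}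
    (h : ∀ i u, φ (xpow i u) = ψ (xpow i u)) (f : FreeExp F A) : φ f = ψ f := by
  refine freeExp_mem (S := LinearMap.eqLocus (φ : FreeExp F A →ₗ[F] B) (ψ : FreeExp F A →ₗ[F] B))
    ?_ h f
  intro a ha b hb
  have ha' : φ a = ψ a := ha
  have hb' : φ b = ψ b := hb
  change φ (a * b) = ψ (a * b)
  rw [map_mul, map_mul, ha', hb']

/-- The substitution `x_i^u ↦ x_{σ i}^{u * c i}`, as an endomorphism of the tensor algebra. -/
noncomputable def tensorSubst (σ : ℕ → ℕ) (c : ℕ → A) :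
    TensorAlgebra F (ℕ →₀ A) →ₐ[F] TensorAlgebra F (ℕ →₀ A) :=
  TensorAlgebra.lift F (TensorAlgebra.ι F ∘ₗ
    Finsupp.lsum F fun i => Finsupp.lsingle (σ i) ∘ₗ LinearMap.mulRight F (c i))

theorem tensorSubst_mem (σ : ℕ → ℕ) (c : ℕ → A) {t : TensorAlgebra F (ℕ →₀ A)}
    (ht : t ∈ augIdeal F (ℕ →₀ A)) : tensorSubst σ c t ∈ augIdeal F (ℕ →₀ A) := by
  have : (TensorAlgebra.algebraMapInv (R := F)).comp (tensorSubst (F := F) σ c)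
      = TensorAlgebra.algebraMapInv := by
    apply TensorAlgebra.hom_ext
    ext i u
    simp [tensorSubst, TensorAlgebra.algebraMapInv]
  exact (DFunLike.congr_fun this t).trans ht

/-- The substitution `x_i^u ↦ x_{σ i}^{u * c i}` of the free algebra with exponents. -/
noncomputable def subst (σ : ℕ → ℕ) (c : ℕ → A) : FreeExp F A →ₙₐ[F] FreeExp F A where
  toFun f := ⟨tensorSubst σ c f.1, tensorSubst_mem σ c f.2⟩
  map_smul' r f := Subtype.ext (map_smul (tensorSubst σ c) r f.1)
  map_zero' := Subtype.ext (map_zero (tensorSubst σ c))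
  map_add' f g := Subtype.ext (map_add (tensorSubst σ c) f.1 g.1)
  map_mul' f g := Subtype.ext (map_mul (tensorSubst σ c) f.1 g.1)

theorem subst_xpow (σ : ℕ → ℕ) (c : ℕ → A) (i : ℕ) (u : A) :
    subst (F := F) σ c (xpow i u) = xpow (σ i) (u * c i) := by
  apply Subtype.ext
  change tensorSubst σ c (TensorAlgebra.ι F (Finsupp.single i u)) = _
  simp [tensorSubst, xpow]

/-- The substitutions multiply exponents on the right, so they commute with the derivations
`expDer`, which multiply them on the left. -/
theorem subst_expDer (σ : ℕ → ℕ) (c : ℕ → A) (d : A) (f : FreeExp F A) :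
    subst σ c (expDer F A d f) = expDer F A d (subst σ c f) := by
  let T : FreeExp F A →ₗ[F] FreeExp F A := (subst σ c : FreeExp F A →ₙₐ[F] FreeExp F A)
  refine freeExp_mem (S := LinearMap.eqLocus (T ∘ₗ expDer F A d) (expDer F A d ∘ₗ T)) ?_ ?_ f
  · intro a ha b hb
    have ha' : subst σ c (expDer F A d a) = expDer F A d (subst σ c a) := ha
    have hb' : subst σ c (expDer F A d b) = expDer F A d (subst σ c b) := hb
    change subst σ c (expDer F A d (a * b)) = expDer F A d (subst σ c (a * b))
    rw [expDer_mul, map_add, map_mul, map_mul, map_mul, expDer_mul, ha', hb']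
  · intro i u
    change subst σ c (expDer F A d (xpow i u)) = expDer F A d (subst σ c (xpow i u))
    rw [expDer_xpow, subst_xpow, subst_xpow, expDer_xpow, mul_assoc]

end FreeExp

/-! ### The `U`-identities of `M_k(F)` form a `T_U`-ideal -/

section Identities

variable {F : Type*} [Field F] {k : ℕ}

theorem act_ι (δ : L F k) (f : FU F k) :
    act F k (UniversalEnvelopingAlgebra.ι F δ) f = lieAct F k δ f := by
  rw [act, UniversalEnvelopingAlgebra.lift_ι_apply]

theorem isLEndo_subst (σ : ℕ → ℕ) (c : ℕ → U F k) : IsLEndo (subst (F := F) σ c) := by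
  intro v f
  refine envelopingAlgebra_intertwine (act F k) (act F k)
    (subst σ c : FU F k →ₙₐ[F] FU F k) (fun x p => ?_) v f
  rw [act_ι, act_ι]
  exact subst_expDer _ _ _ _

theorem evalU_xpow (a : ℕ → Mat F k) (i : ℕ) (u : U F k) :
    evalU F k a (xpow i u) = u.1 (a i) := expEval_xpow _ _ _ _

theorem phi_ι (δ : L F k) : phi F k (UniversalEnvelopingAlgebra.ι F δ) = adL F k δ := by
  rw [phi, UniversalEnvelopingAlgebra.lift_ι_apply]

theorem evalU_lieAct (a : ℕ → Mat F k) (δ : L F k) (f : FU F k) :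
    evalU F k a (lieAct F k δ f) = adL F k δ (evalU F k a f) := by
  let T : FU F k →ₗ[F] Mat F k := (evalU F k a : FU F k →ₙₐ[F] Mat F k)
  refine freeExp_mem (S := LinearMap.eqLocus (T ∘ₗ lieAct F k δ) (adL F k δ ∘ₗ T)) ?_ ?_ f
  · intro f hf g hg
    have hf' : evalU F k a (lieAct F k δ f) = adL F k δ (evalU F k a f) := hf
    have hg' : evalU F k a (lieAct F k δ g) = adL F k δ (evalU F k a g) := hg
    change evalU F k a (lieAct F k δ (f * g)) = adL F k δ (evalU F k a (f * g))
    rw [lieAct_mul, map_add, map_mul, map_mul, map_mul, hf', hg', adL_apply, adL_apply, adL_apply]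
    noncomm_ring
  · intro i u
    change evalU F k a (lieAct F k δ (xpow i u)) = adL F k δ (evalU F k a (xpow i u))
    rw [lieAct_xpow, evalU_xpow, evalU_xpow, ← phi_ι]
    rfl

theorem evalU_act (a : ℕ → Mat F k) (v : UL F k) (f : FU F k) :
    evalU F k a (act F k v f) = phi F k v (evalU F k a f) := by
  refine envelopingAlgebra_intertwine (act F k) (phi F k)
    (evalU F k a : FU F k →ₙₐ[F] Mat F k) (fun x p => ?_) v f
  rw [act_ι, phi_ι]
  exact evalU_lieAct _ _ _

theorem act_xpow (v : UL F k) (i : ℕ) (u : U F k) :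
    act F k v (xpow i u) = xpow i ((phi F k).rangeRestrict v * u) := by
  let T : U F k →ₗ[F] FU F k :=
    { toFun := fun u => xpow i u
      map_add' := xpow_add i
      map_smul' := fun r u => xpow_smul r i u }
  exact (envelopingAlgebra_intertwine
    ((Algebra.lmul F (U F k)).comp (phi F k).rangeRestrict) (act F k) T
    (fun x p => by rw [act_ι]; exact (lieAct_xpow x i p).symm) v u).symm

/-- Composing an evaluation with an `L`-endomorphism is again an evaluation. -/
theorem evalU_endo (a : ℕ → Mat F k) {ψ : FU F k →ₙₐ[F] FU F k} (hψ : IsLEndo ψ) (f : FU F k) :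
    evalU F k a (ψ f) = evalU F k (fun i => evalU F k a (ψ (xpow i 1))) f := by
  refine freeExp_hom_ext (φ := (evalU F k a).comp ψ) (fun i u => ?_) f
  obtain ⟨v, hv⟩ : ∃ v, phi F k v = u.1 := u.2
  have hu : u = (phi F k).rangeRestrict v := Subtype.ext hv.symm
  have h : xpow i u = act F k v (xpow i 1) := by rw [act_xpow, mul_one, hu]
  rw [evalU_xpow, ← hv, h, NonUnitalAlgHom.comp_apply, hψ, evalU_act]

theorem isTUIdeal_UIdentities : IsTUIdeal (UIdentities F k) where
  mul_mem_left g f hf a := by rw [map_mul, hf a, mul_zero]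
  mul_mem_right g f hf a := by rw [map_mul, hf a, zero_mul]
  act_mem v f hf a := by rw [evalU_act, hf a, map_zero]
  endo_mem ψ hψ f hf a := by rw [evalU_endo a hψ, hf]

end Identities

/-! ### The structure of `U` -/

section StructureU

variable {F : Type*} [Field F] {k : ℕ}

theorem trace_comm_sub (x y : Mat F k) : (x * y - y * x).trace = 0 := by
  rw [Matrix.trace_sub, Matrix.trace_mul_comm, sub_self]

/-- The elements of `U` act on the scalar matrices by scalars, and preserve the traceless
matrices. -/
theorem U_apply (u : U F k) :
    (∃ r : F, u.1 1 = r • 1) ∧ ∀ b : Mat F k, b.trace = 0 → (u.1 b).trace = 0 := by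
  let S : Subalgebra F (Module.End F (Mat F k)) :=
    { carrier := {u | (∃ r : F, u 1 = r • 1) ∧ ∀ b : Mat F k, b.trace = 0 → (u b).trace = 0}
      mul_mem' := by
        rintro u v ⟨⟨r, hr⟩, hu⟩ ⟨⟨s, hs⟩, hv⟩
        refine ⟨⟨s * r, ?_⟩, fun b hb => hu _ (hv b hb)⟩
        rw [Module.End.mul_apply, hs, map_smul, hr, smul_smul]
      add_mem' := by
        rintro u v ⟨⟨r, hr⟩, hu⟩ ⟨⟨s, hs⟩, hv⟩
        refine ⟨⟨r + s, ?_⟩, fun b hb => ?_⟩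
        · rw [LinearMap.add_apply, hr, hs, add_smul]
        · rw [LinearMap.add_apply, Matrix.trace_add, hu b hb, hv b hb, add_zero]
      algebraMap_mem' := fun r => by
        refine ⟨⟨r, by rw [Module.algebraMap_end_apply]⟩, fun b hb => ?_⟩
        rw [Module.algebraMap_end_apply, Matrix.trace_smul, hb, smul_zero] }
  have hS : S.comap (phi F k) = ⊤ := envelopingAlgebra_subalgebra_eq_top fun x => by
    change phi F k _ ∈ S
    rw [phi_ι]
    refine ⟨⟨0, ?_⟩, fun b _ => ?_⟩
    · rw [adL_apply, mul_one, one_mul, sub_self, zero_smul]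
    · rw [adL_apply, trace_comm_sub]
  obtain ⟨v, hv⟩ : ∃ v, phi F k v = u.1 := u.2
  have h : v ∈ S.comap (phi F k) := hS ▸ Algebra.mem_top
  rw [← hv]
  exact h

variable [CharZero F] (hk : 2 ≤ k)
include hk

/-- The elements of `U` of rank one: since `M_k(F)` is the sum of the two non-isomorphic simple
modules of scalar and of traceless matrices, `U` contains all endomorphisms `x ↦ f(x) b` with
`f(1) = 0` and `b` traceless. -/
theorem smulRight_mem_U (f : Module.Dual F (Mat F k)) (hf : f 1 = 0) {b : Mat F k}
    (hb : b.trace = 0) : f.smulRight b ∈ U F k := by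
  let i : Fin k := ⟨0, by omega⟩
  let j : Fin k := ⟨1, by omega⟩
  have hij : i ≠ j := by simp [i, j]
  -- for the functional `x ↦ x i j` the admissible `b` form a submodule containing `e_{ij}`
  have h1 : ∀ b : Mat F k, b.trace = 0 →
      (Matrix.entryLinearMap F F i j : Module.Dual F (Mat F k)).smulRight b ∈ U F k := by
    intro b hb
    refine mem_of_stable (i := i) (j := j) (S := (U F k).toSubmodule.comap
      (LinearMap.smulRightₗ (Matrix.entryLinearMap F F i j : Module.Dual F (Mat F k))))
      (fun p q hpq m hm => ?_) hij ?_ hb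
    · have := (U F k).mul_mem (adL_mem F (LieAlgebra.SpecialLinear.single p q hpq 1)) hm
      change _ ∈ U F k
      convert this using 1
      ext x : 1
      change _ = adE F p q hpq _
      simp [adE_apply, smul_sub]
    · have := phi_same_mem F hk i j hij
      change _ ∈ U F k
      convert this using 1
      ext x : 1
      rw [phiAB_apply]
      rfl
  -- for fixed `b` the matrices `y` with admissible `x ↦ tr (y x)` form a submodule containing `e_{ji}`
  let y : Mat F k := Matrix.of fun p q => f (E F q p)
  let tr : Mat F k →ₗ[F] Module.Dual F (Mat F k) :=
    (LinearMap.mul F (Mat F k)).compr₂ (Matrix.traceLinearMap (Fin k) F F)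
  have hy : f = tr y := by
    refine mat_ext fun p q => ?_
    change _ = Matrix.trace (y * E F p q)
    rw [Matrix.trace_mul_single]
    simp [y]
  have hty : y.trace = 0 := by
    rw [← hf, ← Matrix.sum_single_one, map_sum]
    rfl
  rw [hy]
  refine mem_of_stable (i := j) (j := i) (m := y) (S := (U F k).toSubmodule.comap
    ((LinearMap.smulRightₗ (R := F) (M := Mat F k) (M₂ := Mat F k)).flip b ∘ₗ tr))
    (fun p q hpq m hm => ?_) hij.symm ?_ hty
  · have := (U F k).neg_mem ((U F k).mul_mem hm
      (adL_mem F (LieAlgebra.SpecialLinear.single p q hpq 1)))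
    change _ ∈ U F k
    convert this using 1
    ext x : 1
    change Matrix.trace ((E F p q * m - m * E F p q) * x) • b
      = -(Matrix.trace (m * (E F p q * x - x * E F p q)) • b)
    rw [← neg_smul, ← Matrix.trace_neg]
    congr 1
    rw [sub_mul, mul_sub, neg_sub, Matrix.trace_sub, Matrix.trace_sub, mul_assoc (E F p q),
      Matrix.trace_mul_comm (E F p q), mul_assoc, mul_assoc]
  · change _ ∈ U F k
    convert h1 b hb using 1
    ext x : 1
    change Matrix.trace (E F j i * x) • b = x i j • b
    rw [Matrix.trace_single_mul]
    simp

omit hk in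
/-- The projection of `M_k(F)` to the scalar matrices for the index of `g`, and to the traceless
matrices for the other indices of the basis. -/
noncomputable def isotypic (a : BIdx k) : Mat F k →ₗ[F] Mat F k :=
  let sc := ((k : F)⁻¹ • Matrix.traceLinearMap (Fin k) F F).smulRight (1 : Mat F k)
  match a with
  | .g => sc
  | _ => LinearMap.id - sc

omit [CharZero F] in
omit hk in
theorem isotypic_g_apply (b : Mat F k) : isotypic .g b = ((k : F)⁻¹ * b.trace) • 1 := rfl

omit [CharZero F] in
omit hk in
theorem isotypic_of_ne {a : BIdx k} (ha : a ≠ .g) (b : Mat F k) :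
    isotypic a b = b - ((k : F)⁻¹ * b.trace) • 1 := by
  cases a with
  | g => exact absurd rfl ha
  | h l => rfl
  | e i j hij => rfl

theorem trace_isotypic {a : BIdx k} (ha : a ≠ .g) (b : Mat F k) : (isotypic a b).trace = 0 := by
  have hk0 : (k : F) ≠ 0 := Nat.cast_ne_zero.2 (by omega)
  rw [isotypic_of_ne ha]
  simp
  field_simp
  simp

theorem bcoord_bvec (a b : BIdx k) [Decidable (a = b)] :
    bcoord F a (bvec F b) = if a = b then 1 else 0 := by
  split_ifs with h
  · rw [h, (dualBases F hk).eval_same]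
  · exact (dualBases F hk).eval_of_ne h

theorem bcoord_one {a : BIdx k} (ha : a ≠ .g) : bcoord F a 1 = 0 :=
  (dualBases F hk).eval_of_ne ha

/-- The element `x ↦ μ_a(x) b` of `U`, where `μ_a` is a coordinate functional of the basis and `b`
is a scalar matrix for `a = g` and a traceless one for `a ≠ g`. -/
noncomputable def letterU (a : BIdx k) : Mat F k →ₗ[F] U F k :=
  LinearMap.codRestrict (U F k).toSubmodule
    ((LinearMap.smulRightₗ (bcoord F a)) ∘ₗ isotypic a) (fun b => by
      change (bcoord F a).smulRight (isotypic a b) ∈ U F k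
      by_cases ha : a = .g
      · subst ha
        convert (U F k).smul_mem (phi_gg_mem F hk) ((k : F)⁻¹ * b.trace) using 1
        ext x : 1
        rw [LinearMap.smul_apply, phiAB_apply, isotypic_g_apply, LinearMap.smulRight_apply,
          smul_comm]
        rfl
      · exact smulRight_mem_U hk _ (bcoord_one hk ha) (trace_isotypic hk ha b))

theorem letterU_apply (a : BIdx k) (b x : Mat F k) :
    (letterU (F := F) hk a b).1 x = bcoord F a x • isotypic a b := rfl

/-- The matrices `b` that are allowed in `letterU a b`. -/
def ValidLetter (a : BIdx k) (b : Mat F k) : Prop :=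
  (a = .g → ∃ r : F, b = r • 1) ∧ (a ≠ .g → b.trace = 0)

theorem isotypic_of_valid {a : BIdx k} {b : Mat F k}
    (h : ValidLetter a b) : isotypic a b = b := by
  have hk0 : (k : F) ≠ 0 := Nat.cast_ne_zero.2 (by omega)
  by_cases ha : a = .g
  · obtain ⟨r, rfl⟩ := h.1 ha
    subst ha
    rw [isotypic_g_apply]
    simp
    rw [mul_comm r, inv_mul_cancel_left₀ hk0]
  · rw [isotypic_of_ne ha, h.2 ha]
    simp

/-- The elements `letterU a b` span `U`. -/
theorem mem_span_letterU (u : U F k) :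
    u ∈ Submodule.span F {v : U F k | ∃ a b, ValidLetter a b ∧ v = letterU hk a b} := by
  classical
  let _ : Fintype (BIdx k) := Fintype.ofFinite _
  have hv : ∀ a : BIdx k, ValidLetter a (u.1 (bvec F a)) := by
    intro a
    refine ⟨?_, fun ha => (U_apply u).2 _ ?_⟩
    · rintro rfl
      exact (U_apply u).1
    · have h2 : bcoord F .g (bvec F a) = 0 := (dualBases F hk).eval_of_ne (Ne.symm ha)
      have hk0 : (k : F) ≠ 0 := Nat.cast_ne_zero.2 (by omega)
      simpa [bcoord, hk0] using h2
  have h : u = ∑ a : BIdx k, letterU hk a (u.1 (bvec F a)) := by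
    apply Subtype.ext
    refine (basisM F hk).ext fun a => ?_
    rw [basisM_apply, AddSubmonoidClass.coe_finsetSum, LinearMap.sum_apply, Finset.sum_eq_single a]
    · rw [letterU_apply, bcoord_bvec hk, if_pos rfl, one_smul, isotypic_of_valid hk (hv a)]
    · intro b _ hb
      rw [letterU_apply, bcoord_bvec hk, if_neg hb, zero_smul]
    · intro h; exact absurd (Finset.mem_univ a) h
  rw [h]
  exact Submodule.sum_mem _ fun a _ => Submodule.subset_span ⟨a, _, hv a, rfl⟩

/-- Left multiplication by the commutator with `e_{ij}` acts on the matrix of a letter. -/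
theorem adL_mul_letterU (i j : Fin k) (hij : i ≠ j) {a : BIdx k} (ha : a ≠ .g) (b : Mat F k) :
    (phi F k).rangeRestrict (UniversalEnvelopingAlgebra.ι F
      (LieAlgebra.SpecialLinear.single i j hij 1)) * letterU hk a b
      = letterU hk a (E F i j * b - b * E F i j) := by
  apply Subtype.ext
  ext x : 1
  change phi F k (UniversalEnvelopingAlgebra.ι F _) ((letterU hk a b).1 x) = _
  rw [phi_ι, letterU_apply, letterU_apply, map_smul, isotypic_of_ne ha, isotypic_of_ne ha,
    trace_comm_sub]
  change _ • adE F i j hij _ = _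
  simp [adE_apply, mul_sub, sub_mul]

theorem adL_mul_letterU_g (δ : L F k) (b : Mat F k) :
    (phi F k).rangeRestrict (UniversalEnvelopingAlgebra.ι F δ) * letterU hk .g b = 0 := by
  apply Subtype.ext
  ext x : 1
  change phi F k (UniversalEnvelopingAlgebra.ι F _) ((letterU hk .g b).1 x) = 0
  rw [phi_ι, letterU_apply, isotypic_g_apply, map_smul, map_smul, adL_apply]
  simp

theorem exp_gg_eq : exp_gg F hk = letterU hk .g 1 := by
  apply Subtype.ext
  ext x : 1
  have h := isotypic_of_valid (F := F) hk (a := .g) (b := 1) ⟨fun _ => ⟨1, by simp⟩, by simp⟩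
  rw [letterU_apply, h]
  exact phiAB_apply F hk _ _ _

/-- Left multiplication by `φ_{e_{12}, e_{pq}}` changes the matrix of a letter from `e_{12}`
to `e_{pq}`. -/
theorem phiAB_mul_letterU {i j p q : Fin k} (hij : i ≠ j) (hpq : p ≠ q)
    (hU : phiAB F hk (.e i j hij) (.e p q hpq) ∈ U F k) {a : BIdx k} (ha : a ≠ .g) :
    ⟨phiAB F hk (.e i j hij) (.e p q hpq), hU⟩ * letterU hk a (E F i j)
      = letterU hk a (E F p q) := by
  apply Subtype.ext
  ext x : 1
  change phiAB F hk (.e i j hij) (.e p q hpq) ((letterU hk a (E F i j)).1 x) = _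
  rw [letterU_apply, letterU_apply,
    isotypic_of_valid hk ⟨fun h => absurd h ha, fun _ => by simp [hij]⟩,
    isotypic_of_valid hk ⟨fun h => absurd h ha, fun _ => by simp [hpq]⟩,
    map_smul, phiAB_apply]
  simp [bcoord, bvec]

end StructureU

/-! ### Quotients and homomorphisms of free algebras with exponents -/

section FreeQuotient

universe u v
variable {F : Type u} {A : Type v} [Field F] [Ring A] [Algebra F A]

theorem exists_eq_algebraMap_add (t : TensorAlgebra F (ℕ →₀ A)) :
    ∃ (r : F) (f : FreeExp F A), t = algebraMap F _ r + valLin f := by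
  obtain ⟨g, -, hg⟩ := sub_algebraMap_mem (F := F) (A := A) (S := ⊤) (by simp) (by simp) t
  exact ⟨_, g, by rw [hg, add_sub_cancel]⟩

/-- A two-sided ideal of the free algebra with exponents, as an ideal of the tensor algebra. -/
noncomputable def tensorIdeal {I : Submodule F (FreeExp F A)} (hl : ∀ g, ∀ f ∈ I, g * f ∈ I) :
    Ideal (TensorAlgebra F (ℕ →₀ A)) where
  carrier := I.map valLin
  add_mem' := Submodule.add_mem _
  zero_mem' := Submodule.zero_mem _
  smul_mem' := by
    rintro t _ ⟨f, hf, rfl⟩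
    obtain ⟨r, g, rfl⟩ := exists_eq_algebraMap_add t
    refine ⟨r • f + g * f, I.add_mem (I.smul_mem _ hf) (hl g f hf), ?_⟩
    rw [map_add, valLin_mul, map_smul, Algebra.smul_def, ← add_mul, smul_eq_mul]

theorem isTwoSided_tensorIdeal {I : Submodule F (FreeExp F A)} (hl : ∀ g, ∀ f ∈ I, g * f ∈ I)
    (hr : ∀ g, ∀ f ∈ I, f * g ∈ I) : (tensorIdeal hl).IsTwoSided where
  mul_mem_of_left := by
    rintro _ t ⟨f, hf, rfl⟩
    obtain ⟨r, g, rfl⟩ := exists_eq_algebraMap_add t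
    refine ⟨r • f + f * g, I.add_mem (I.smul_mem _ hf) (hr g f hf), ?_⟩
    rw [map_add, valLin_mul, map_smul, Algebra.smul_def, Algebra.commutes, ← mul_add]

/-- The quotient of the free algebra with exponents by a two-sided ideal, with a unit adjoined. -/
theorem exists_quotient {I : Submodule F (FreeExp F A)} (hl : ∀ g, ∀ f ∈ I, g * f ∈ I)
    (hr : ∀ g, ∀ f ∈ I, f * g ∈ I) :
    ∃ (B : Type max u v) (_ : Ring B) (_ : Algebra F B) (P : FreeExp F A →ₙₐ[F] B),
      (∀ x : B, ∃ (r : F) (f : FreeExp F A), x = algebraMap F B r + P f) ∧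
      ∀ f, P f = 0 ↔ f ∈ I := by
  have := isTwoSided_tensorIdeal hl hr
  let q := Ideal.Quotient.mkₐ F (tensorIdeal hl)
  let P : FreeExp F A →ₙₐ[F] (TensorAlgebra F (ℕ →₀ A) ⧸ tensorIdeal hl) :=
    (q : TensorAlgebra F (ℕ →₀ A) →ₙₐ[F] _).comp
      (NonUnitalSubalgebraClass.subtype (augIdeal F (ℕ →₀ A)))
  refine ⟨_, inferInstance, inferInstance, P, fun x => ?_, fun f => ?_⟩
  · obtain ⟨t, rfl⟩ := Ideal.Quotient.mk_surjective x
    obtain ⟨r, f, rfl⟩ := exists_eq_algebraMap_add t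
    exact ⟨r, f, map_add q _ _⟩
  · refine (Ideal.Quotient.eq_zero_iff_mem (I := tensorIdeal hl) (a := valLin f)).trans
      ⟨?_, fun h => ⟨f, h, rfl⟩⟩
    rintro ⟨g, hg, hgf⟩
    rwa [← valLin_injective hgf]

/-- The homomorphism of the free algebra with exponents with `x_i^u ↦ η i u`. -/
noncomputable def freeLift {B : Type*} [Ring B] [Algebra F B] (η : ℕ → A →ₗ[F] B) :
    FreeExp F A →ₙₐ[F] B :=
  ((TensorAlgebra.lift F (Finsupp.lsum F η) : TensorAlgebra F (ℕ →₀ A) →ₐ[F] B) :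
    TensorAlgebra F (ℕ →₀ A) →ₙₐ[F] B).comp
      (NonUnitalSubalgebraClass.subtype (augIdeal F (ℕ →₀ A)))

theorem freeLift_xpow {B : Type*} [Ring B] [Algebra F B] (η : ℕ → A →ₗ[F] B) (i : ℕ) (u : A) :
    freeLift η (xpow i u) = η i u := by
  change TensorAlgebra.lift F (Finsupp.lsum F η) (TensorAlgebra.ι F (Finsupp.single i u)) = _
  simp

/-- The linear map `u ↦ x_n^u`. -/
noncomputable def xpowLin (n : ℕ) : A →ₗ[F] FreeExp F A where
  toFun u := xpow n u
  map_add' := xpow_add n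
  map_smul' r u := xpow_smul r n u

/-- Over a field, a linear map factors through every linear map with smaller kernel. -/
theorem exists_factor {X Y Z : Type*} [AddCommGroup X] [Module F X] [AddCommGroup Y] [Module F Y]
    [AddCommGroup Z] [Module F Z] (f : X →ₗ[F] Y) (g : X →ₗ[F] Z)
    (h : ∀ x, f x = 0 → g x = 0) : ∃ D : Y →ₗ[F] Z, ∀ x, D (f x) = g x := by
  obtain ⟨s, hs⟩ := f.rangeRestrict.exists_rightInverse_of_surjective f.range_rangeRestrict
  obtain ⟨D, hD⟩ := (g ∘ₗ s).exists_extend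
  refine ⟨D, fun x => ?_⟩
  have h1 : D (f x) = g (s (f.rangeRestrict x)) := DFunLike.congr_fun hD (f.rangeRestrict x)
  have h2 : f (s (f.rangeRestrict x)) = f x :=
    congrArg Subtype.val (DFunLike.congr_fun hs (f.rangeRestrict x))
  have h3 := h (s (f.rangeRestrict x) - x) (by rw [map_sub, h2, sub_self])
  rw [map_sub, sub_eq_zero] at h3
  rw [h1, h3]

end FreeQuotient

/-! ### Letters in the quotient by a `T_U`-ideal -/

section Quotient

variable {F : Type*} [Field F] {k : ℕ}

variable [CharZero F] (hk : 2 ≤ k) {A : Type*} [Ring A] [Algebra F A]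
  (P : FU F k →ₙₐ[F] A)

/-- The image in `A` of the symbols `x_n^{a b}`: the letter of type `(n, a)`. -/
noncomputable def letterA (t : ℕ × BIdx k) : Mat F k →ₗ[F] A :=
  (P : FU F k →ₗ[F] A) ∘ₗ xpowLin t.1 ∘ₗ letterU hk t.2

theorem letterA_apply (t : ℕ × BIdx k) (b : Mat F k) :
    letterA hk P t b = P (xpow t.1 (letterU hk t.2 b)) := rfl

variable {P} {I : Submodule F (FU F k)} (hI : IsTUIdeal I) (hP : ∀ f, P f = 0 ↔ f ∈ I)
include hI hP

omit [CharZero F] in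
/-- The Lie algebra acts on the quotient. -/
theorem exists_derivation (i j : Fin k) (hij : i ≠ j) : ∃ D : A →ₗ[F] A, ∀ f,
    D (P f) = P (lieAct F k (LieAlgebra.SpecialLinear.single i j hij 1) f) := by
  refine exists_factor (P : FU F k →ₗ[F] A)
    ((P : FU F k →ₗ[F] A) ∘ₗ lieAct F k (LieAlgebra.SpecialLinear.single i j hij 1)) ?_
  intro f hf
  change P _ = 0
  rw [hP, ← act_ι]
  exact hI.act_mem _ _ ((hP f).1 hf)

theorem equivariant_letterA {t u : ℕ × BIdx k} (ht : t.2 ≠ .g) (hu : u.2 ≠ .g) :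
    Equivariant ((LinearMap.mul F A).compl₁₂ (letterA hk P t) (letterA hk P u)) := by
  intro i j hij
  obtain ⟨D, hD⟩ := exists_derivation hI hP i j hij
  refine ⟨D, fun a b => ?_⟩
  simp only [LinearMap.compl₁₂_apply, LinearMap.mul_apply', letterA_apply]
  rw [← map_mul, hD, lieAct_mul, lieAct_xpow, lieAct_xpow,
    adL_mul_letterU hk i j hij ht, adL_mul_letterU hk i j hij hu]
  simp only [map_add, map_mul]

/-- The image of `x_n^{gg}` is central in the quotient, as soon as it commutes with the image of
the other `x_m^{gg}` and of the `x_m^{a e_{ij}}`. -/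
theorem central_of_mem (hsurj : ∀ x : A, ∃ (r : F) (f : FU F k), x = algebraMap F A r + P f)
    (h3 : ∀ n m, (xpow n (letterU (F := F) hk .g 1) * xpow m (letterU (F := F) hk .g 1)
      - xpow m (letterU (F := F) hk .g 1) * xpow n (letterU (F := F) hk .g 1) : FU F k) ∈ I)
    (h4 : ∃ i j : Fin k, i ≠ j ∧ ∀ n m a, a ≠ .g →
      (xpow n (letterU (F := F) hk .g 1) * xpow m (letterU hk a (E F i j))
        - xpow m (letterU hk a (E F i j)) * xpow n (letterU (F := F) hk .g 1) : FU F k) ∈ I)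
    (n : ℕ) (x : A) : letterA hk P (n, .g) 1 * x = x * letterA hk P (n, .g) 1 := by
  obtain ⟨i, j, hij, h4⟩ := h4
  set z := letterA hk P (n, .g) 1 with hz
  -- the matrices whose letters commute with `z` form a submodule, as `sl_k` annihilates `z`
  have key : ∀ m a b, ValidLetter a b →
      z * letterA hk P (m, a) b = letterA hk P (m, a) b * z := by
    intro m a b hb
    by_cases ha : a = .g
    · subst ha
      obtain ⟨r, rfl⟩ := hb.1 rfl
      have := (hP _).2 (h3 n m)
      rw [map_sub, map_mul, map_mul, sub_eq_zero] at this
      rw [map_smul, mul_smul_comm, smul_mul_assoc]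
      exact congrArg _ this
    · refine mem_of_stable (i := i) (j := j) (S := LinearMap.eqLocus
        (LinearMap.mulLeft F z ∘ₗ letterA hk P (m, a))
        (LinearMap.mulRight F z ∘ₗ letterA hk P (m, a))) (fun p r hpr c hc => ?_) hij ?_ (hb.2 ha)
      · obtain ⟨D, hD⟩ := exists_derivation hI hP p r hpr
        have hc' : z * letterA hk P (m, a) c = letterA hk P (m, a) c * z := hc
        have h5 := congrArg D hc'
        simp only [hz, letterA_apply] at h5
        rw [← map_mul, ← map_mul, hD, hD, lieAct_mul, lieAct_mul,
          lieAct_xpow, lieAct_xpow, adL_mul_letterU hk p r hpr ha, adL_mul_letterU_g] at h5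
        have h0 : (xpow n (0 : U F k) : FU F k) = 0 := map_zero (xpowLin n)
        rw [h0, zero_mul, mul_zero, zero_add, add_zero, map_mul, map_mul] at h5
        exact h5
      · have := (hP _).2 (h4 n m a ha)
        rw [map_sub, map_mul, map_mul, sub_eq_zero] at this
        exact this
  have hf : ∀ f, z * P f = P f * z := by
    intro f
    refine freeExp_mem (S := LinearMap.eqLocus (LinearMap.mulLeft F z ∘ₗ (P : FU F k →ₗ[F] A))
      (LinearMap.mulRight F z ∘ₗ (P : FU F k →ₗ[F] A))) ?_ (fun m u => ?_) f
    · intro f hf g hg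
      have hf' : z * P f = P f * z := hf
      have hg' : z * P g = P g * z := hg
      change z * P (f * g) = P (f * g) * z
      rw [map_mul, ← mul_assoc, hf', mul_assoc, hg', mul_assoc]
    · have hle : Submodule.span F {v : U F k | ∃ a b, ValidLetter a b ∧ v = letterU hk a b}
          ≤ LinearMap.eqLocus (LinearMap.mulLeft F z ∘ₗ (P : FU F k →ₗ[F] A) ∘ₗ xpowLin m)
            (LinearMap.mulRight F z ∘ₗ (P : FU F k →ₗ[F] A) ∘ₗ xpowLin m) := by
        rw [Submodule.span_le]
        rintro _ ⟨a, b, hb, rfl⟩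
        exact key m a b hb
      exact hle (mem_span_letterU hk u)
  obtain ⟨r, f, rfl⟩ := hsurj x
  rw [mul_add, add_mul, hf, Algebra.commutes]

/-- The products of two letters depend only on the product of their matrices, and symmetrically on
their types. -/
theorem exists_factor_letterA
    (h1 : (∃ i j p : Fin k, i ≠ j ∧ i ≠ p ∧ j ≠ p ∧ ∀ n m a b, a ≠ .g → b ≠ .g →
        (xpow n (letterU hk a (E F i j)) * xpow m (letterU hk b (E F p i)) : FU F k) ∈ I) ∨
      ∃ i j : Fin k, i ≠ j ∧ (∀ p, p = i ∨ p = j) ∧ ∀ n m a b, a ≠ .g → b ≠ .g →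
        (xpow n (letterU hk a (E F i j)) * xpow m (letterU hk b (E F i j)) : FU F k) ∈ I)
    (h2 : ∃ i j : Fin k, i ≠ j ∧ ∀ n m a b, a ≠ .g → b ≠ .g →
      (xpow n (letterU hk a (E F i j)) * xpow m (letterU hk b (E F j i))
        - xpow m (letterU hk b (E F i j)) * xpow n (letterU hk a (E F j i)) : FU F k) ∈ I)
    {t u : ℕ × BIdx k} (ht : t.2 ≠ .g) (hu : u.2 ≠ .g) :
    ∃ N : Mat F k →ₗ[F] A, ∀ a b, a.trace = 0 → b.trace = 0 →
      letterA hk P t a * letterA hk P u b = N (a * b) ∧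
      letterA hk P u a * letterA hk P t b = N (a * b) := by
  have fac : ∀ t u : ℕ × BIdx k, t.2 ≠ .g → u.2 ≠ .g →
      ∃ N : Mat F k →ₗ[F] A, ∀ a b, a.trace = 0 → b.trace = 0 →
        letterA hk P t a * letterA hk P u b = N (a * b) := by
    intro t u ht hu
    have hB := equivariant_letterA hk hI hP ht hu
    rcases h1 with ⟨i, j, p, hij, hip, hjp, h⟩ | ⟨i, j, hij, hall, h⟩
    · have h0 := (hP _).2 (h t.1 u.1 t.2 u.2 ht hu)
      rw [map_mul] at h0
      refine hB.factor_large (fun a b c d hab hcd hbc => hB.of_ne hij hip hjp h0 hab hcd hbc)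
        fun a b => ?_
      by_contra! hc
      have h1 := hc i; have h2 := hc j; have h3 := hc p
      grind
    · have h0 := (hP _).2 (h t.1 u.1 t.2 u.2 ht hu)
      rw [map_mul] at h0
      exact hB.factor_two hij hall h0
  obtain ⟨N, hN⟩ := fac t u ht hu
  obtain ⟨N', hN'⟩ := fac u t hu ht
  obtain ⟨i, j, hij, h⟩ := h2
  have hB := equivariant_letterA hk hI hP ht hu
  have hB' := equivariant_letterA hk hI hP hu ht
  have hsub : Equivariant ((LinearMap.mul F A).compl₁₂ (letterA hk P t) (letterA hk P u)
      - (LinearMap.mul F A).compl₁₂ (letterA hk P u) (letterA hk P t)) := by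
    intro i j hij
    obtain ⟨D, hD⟩ := exists_derivation hI hP i j hij
    refine ⟨D, fun a b => ?_⟩
    simp only [LinearMap.sub_apply, LinearMap.compl₁₂_apply, LinearMap.mul_apply', letterA_apply]
    rw [map_sub, ← map_mul, ← map_mul, hD, hD, lieAct_mul, lieAct_mul,
      lieAct_xpow, lieAct_xpow, lieAct_xpow, lieAct_xpow,
      adL_mul_letterU hk i j hij ht, adL_mul_letterU hk i j hij hu,
      adL_mul_letterU hk i j hij ht, adL_mul_letterU hk i j hij hu]
    simp only [map_add, map_mul]
    abel
  -- the two orders of the types give the same map, by the second identity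
  have hNN : N - N' = 0 := by
    refine hsub.eq_zero_of_factor hk (fun a b ha hb => ?_) hij ?_
    · simp only [LinearMap.sub_apply, LinearMap.compl₁₂_apply, LinearMap.mul_apply']
      rw [hN a b ha hb, hN' a b ha hb]
    · have h0 := (hP _).2 (h t.1 u.1 t.2 u.2 ht hu)
      rw [map_sub, map_mul, map_mul] at h0
      exact h0
  rw [sub_eq_zero] at hNN
  exact ⟨N, fun a b ha hb => ⟨hN a b ha hb, by rw [hN' a b ha hb, hNN]⟩⟩

end Quotient

/-! ### Generic matrices -/

section Generic

variable {F : Type*} [Field F] {k : ℕ}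

/-- The matrix `t^ν m` over the polynomial ring. -/
noncomputable def monoMat {τ : Type*} (ν : τ →₀ ℕ) :
    Mat F k →ₗ[F] Matrix (Fin k) (Fin k) (MvPolynomial τ F) :=
  (MvPolynomial.monomial ν).mapMatrix

theorem monoMat_mul {τ : Type*} (ν ν' : τ →₀ ℕ) (m m' : Mat F k) :
    monoMat ν m * monoMat ν' m' = monoMat (ν + ν') (m * m') := by
  ext i j : 1
  simp only [monoMat, Matrix.mul_apply, LinearMap.mapMatrix_apply, Matrix.map_apply,
    MvPolynomial.monomial_mul, map_sum]

/-- Coefficientwise, a family of linear maps on `M_k(F)` indexed by the monomials gives a linear map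
on the matrices over the polynomial ring. -/
theorem exists_coeffMap {τ A : Type*} [AddCommGroup A] [Module F A]
    (S : (τ →₀ ℕ) → (Mat F k →ₗ[F] A)) :
    ∃ T : Matrix (Fin k) (Fin k) (MvPolynomial τ F) →ₗ[F] A, ∀ ν m, T (monoMat ν m) = S ν m := by
  refine ⟨∑ i, ∑ j, (MvPolynomial.basisMonomials τ F).constr F (fun ν => S ν (E F i j)) ∘ₗ
    Matrix.entryLinearMap F (MvPolynomial τ F) i j, fun ν m => ?_⟩
  have h : ∀ i j, (MvPolynomial.basisMonomials τ F).constr F (fun ν => S ν (E F i j))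
      (MvPolynomial.monomial ν (m i j)) = S ν (Matrix.single i j (m i j)) := by
    intro i j
    have h1 := (MvPolynomial.basisMonomials τ F).constr_basis F (fun ν => S ν (E F i j)) ν
    rw [MvPolynomial.coe_basisMonomials] at h1
    have h2 : MvPolynomial.monomial ν (m i j) = m i j • MvPolynomial.monomial ν (1 : F) := by
      rw [MvPolynomial.smul_monomial, smul_eq_mul, mul_one]
    rw [h2, map_smul, h1, ← map_smul, Matrix.smul_single, smul_eq_mul, mul_one]
  rw [LinearMap.sum_apply]
  simp only [LinearMap.sum_apply, LinearMap.comp_apply]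
  change ∑ i, ∑ j, _ = _
  conv_rhs => rw [Matrix.matrix_eq_sum_single m]
  simp only [map_sum]
  exact Finset.sum_congr rfl fun i _ => Finset.sum_congr rfl fun j _ => h i j

open Classical in
/-- Substituting for `x_n` the generic matrix `∑ t_{n,a} a`, where `a` runs through the basis. -/
noncomputable def generic :
    FU F k →ₙₐ[F] Matrix (Fin k) (Fin k) (MvPolynomial (ℕ × BIdx k) F) :=
  let _ : Fintype (BIdx k) := Fintype.ofFinite _
  freeLift fun n => ∑ a : BIdx k,
    monoMat (Finsupp.single (n, a) 1) ∘ₗ LinearMap.applyₗ (bvec F a) ∘ₗ (U F k).val.toLinearMap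

theorem generic_xpow [Fintype (BIdx k)] (n : ℕ) (u : U F k) : generic (xpow n u)
    = ∑ a : BIdx k, monoMat (Finsupp.single (n, a) 1) (u.1 (bvec F a)) := by
  rw [generic, freeLift_xpow, LinearMap.sum_apply]
  refine Finset.sum_congr ?_ fun a _ => rfl
  ext; simp

theorem generic_letter [CharZero F] (hk : 2 ≤ k) (n : ℕ) {a : BIdx k} {b : Mat F k}
    (hb : ValidLetter a b) :
    generic (xpow n (letterU hk a b)) = monoMat (Finsupp.single (n, a) 1) b := by
  classical
  let _ : Fintype (BIdx k) := Fintype.ofFinite _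
  rw [generic_xpow, Finset.sum_eq_single a]
  · rw [letterU_apply, bcoord_bvec hk, if_pos rfl, one_smul, isotypic_of_valid hk hb]
  · intro c _ hc
    rw [letterU_apply, bcoord_bvec hk, if_neg (Ne.symm hc), zero_smul, map_zero]
  · intro h; exact absurd (Finset.mem_univ a) h

end Generic

section Generic
variable {F : Type*} [Field F] {k : ℕ}

/-- Specializing the variables of the polynomial ring. -/
theorem exists_specialize {τ : Type*} (c : τ → F) :
    ∃ α : Matrix (Fin k) (Fin k) (MvPolynomial τ F) →ₙₐ[F] Mat F k,
      (∀ x i j, α x i j = MvPolynomial.eval c (x i j)) ∧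
      ∀ t m, α (monoMat (Finsupp.single t 1) m) = c t • m := by
  let α : Matrix (Fin k) (Fin k) (MvPolynomial τ F) →ₐ[F] Mat F k :=
    (MvPolynomial.aeval c : MvPolynomial τ F →ₐ[F] F).mapMatrix
  have h : ∀ x i j, α x i j = MvPolynomial.eval c (x i j) := fun x i j => by
    simp [α, MvPolynomial.aeval_eq_eval]
  refine ⟨α, h, fun t m => ?_⟩
  ext i j
  refine (h _ i j).trans ?_
  simp [monoMat, MvPolynomial.eval_monomial, mul_comm]

/-- A `U`-identity vanishes on generic matrices. -/
theorem generic_eq_zero [CharZero F] {f : FU F k} (hf : f ∈ UIdentities F k) :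
    generic f = 0 := by
  classical
  let _ : Fintype (BIdx k) := Fintype.ofFinite _
  ext i j : 1
  refine MvPolynomial.funext fun c => ?_
  obtain ⟨α, hα, hαm⟩ := exists_specialize (k := k) c
  have key : (α.comp generic) f = evalU F k (fun n => ∑ a : BIdx k, c (n, a) • bvec F a) f := by
    refine freeExp_hom_ext (fun n u => ?_) f
    rw [NonUnitalAlgHom.comp_apply, generic_xpow, evalU_xpow]
    refine (map_sum α _ _).trans (Eq.trans ?_ (map_sum (u.1 : Module.End F (Mat F k)) _ _).symm)
    exact Finset.sum_congr rfl fun a _ => by rw [hαm, map_smul]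
  have h := congrFun (congrFun (key.trans (hf _)) i) j
  rw [NonUnitalAlgHom.comp_apply, hα] at h
  rw [h]
  simp

end Generic

/-! ### Every `U`-identity follows from the generating ones -/

section Generation

variable {F : Type*} [Field F] [CharZero F] {k : ℕ} (hk : 2 ≤ k)

/-- A `T_U`-ideal that contains the four generating identities, for all letters, contains all
`U`-identities: modulo it every monomial is determined by its value on generic matrices. -/
theorem UIdentities_le {I : Submodule F (FU F k)} (hI : IsTUIdeal I)
    (h1 : (∃ i j p : Fin k, i ≠ j ∧ i ≠ p ∧ j ≠ p ∧ ∀ n m a b, a ≠ .g → b ≠ .g →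
        (xpow n (letterU hk a (E F i j)) * xpow m (letterU hk b (E F p i)) : FU F k) ∈ I) ∨
      ∃ i j : Fin k, i ≠ j ∧ (∀ p, p = i ∨ p = j) ∧ ∀ n m a b, a ≠ .g → b ≠ .g →
        (xpow n (letterU hk a (E F i j)) * xpow m (letterU hk b (E F i j)) : FU F k) ∈ I)
    (h2 : ∃ i j : Fin k, i ≠ j ∧ ∀ n m a b, a ≠ .g → b ≠ .g →
      (xpow n (letterU hk a (E F i j)) * xpow m (letterU hk b (E F j i))
        - xpow m (letterU hk b (E F i j)) * xpow n (letterU hk a (E F j i)) : FU F k) ∈ I)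
    (h3 : ∀ n m, (xpow n (letterU (F := F) hk .g 1) * xpow m (letterU (F := F) hk .g 1)
      - xpow m (letterU (F := F) hk .g 1) * xpow n (letterU (F := F) hk .g 1) : FU F k) ∈ I)
    (h4 : ∃ i j : Fin k, i ≠ j ∧ ∀ n m a, a ≠ .g →
      (xpow n (letterU (F := F) hk .g 1) * xpow m (letterU hk a (E F i j))
        - xpow m (letterU hk a (E F i j)) * xpow n (letterU (F := F) hk .g 1) : FU F k) ∈ I) :
    UIdentities F k ≤ I := by
  classical
  obtain ⟨A, _, _, P, hsurj, hP⟩ := exists_quotient hI.mul_mem_left hI.mul_mem_right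
  have hz := central_of_mem hk hI hP hsurj h3 h4
  let w : ℕ × BIdx k → Mat F k →ₗ[F] A := fun t => if t.2 = .g then 0 else letterA hk P t
  obtain ⟨S, hS1, hSz, hSw⟩ := exists_normalForm (p := fun t : ℕ × BIdx k => t.2 = .g) hk w
    (fun t => letterA hk P t 1)
    (fun t u => by
      by_cases ht : t.2 = .g
      · exact ⟨0, by simp [w, ht]⟩
      by_cases hu : u.2 = .g
      · exact ⟨0, by simp [w, hu]⟩
      simpa [w, ht, hu] using exists_factor_letterA hk hI hP h1 h2 ht hu)
    (fun t a ht => by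
      obtain ⟨n, b⟩ := t
      obtain rfl : b = .g := ht
      exact hz n a)
  obtain ⟨T, hT⟩ := exists_coeffMap fun ν : ℕ × BIdx k →₀ ℕ => S (Finsupp.toMultiset ν)
  -- the span of the values of monomials on generic matrices
  let V : Submodule F (Matrix (Fin k) (Fin k) (MvPolynomial (ℕ × BIdx k) F)) :=
    Submodule.span F {x | ∃ (ν : ℕ × BIdx k →₀ ℕ) (m : Mat F k),
      Occurs (fun t : ℕ × BIdx k => t.2 = .g) (Finsupp.toMultiset ν) m ∧ x = monoMat ν m}
  let Pl : FU F k →ₗ[F] A := (P : FU F k →ₗ[F] A)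
  let Gl : FU F k →ₗ[F] Matrix (Fin k) (Fin k) (MvPolynomial (ℕ × BIdx k) F) :=
    (generic : FU F k →ₙₐ[F] _)
  have hPl : ∀ f g, Pl (f * g) = Pl f * Pl g := fun f g => map_mul P f g
  have hGl : ∀ f g, Gl (f * g) = Gl f * Gl g := fun f g => map_mul generic f g
  -- right multiplication by elements of `W` is compatible with `T` on these values
  let W : Submodule F (FU F k) :=
    { carrier := {f | ∀ x ∈ V, x * Gl f ∈ V ∧ T x * Pl f = T (x * Gl f)}
      zero_mem' := fun x _ => by simp
      add_mem' := fun {f g} hf hg x hx => by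
        rw [map_add, map_add, mul_add, mul_add, map_add, (hf x hx).2, (hg x hx).2]
        exact ⟨V.add_mem (hf x hx).1 (hg x hx).1, rfl⟩
      smul_mem' := fun r f hf x hx => by
        rw [map_smul, map_smul, mul_smul_comm, mul_smul_comm, map_smul, (hf x hx).2]
        exact ⟨V.smul_mem r (hf x hx).1, rfl⟩ }
  have hW : ∀ f, f ∈ W := by
    refine freeExp_mem (fun f hf g hg x hx => ?_) fun n u => ?_
    · rw [hPl, hGl, ← mul_assoc, ← mul_assoc, (hf x hx).2]
      exact hg _ (hf x hx).1
    · have hle : Submodule.span F {v : U F k | ∃ a b, ValidLetter a b ∧ v = letterU hk a b}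
          ≤ W.comap (xpowLin n) := by
        rw [Submodule.span_le]
        rintro _ ⟨a, b, hb, rfl⟩
        intro x hx
        have hG : Gl (xpowLin n (letterU hk a b)) = monoMat (Finsupp.single (n, a) 1) b :=
          generic_letter hk n hb
        have hA : Pl (xpowLin n (letterU hk a b)) = letterA hk P (n, a) b := rfl
        rw [hG, hA]
        induction hx using Submodule.span_induction with
        | zero => simp
        | add x y _ _ hx hy =>
          rw [add_mul, map_add, map_add, add_mul, hx.2, hy.2]
          exact ⟨V.add_mem hx.1 hy.1, rfl⟩
        | smul r x _ hx =>
          rw [smul_mul_assoc, map_smul, map_smul, smul_mul_assoc, hx.2]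
          exact ⟨V.smul_mem r hx.1, rfl⟩
        | mem x hx =>
          obtain ⟨ν, m, hm, rfl⟩ := hx
          have hν : Finsupp.toMultiset (ν + Finsupp.single (n, a) 1)
              = (n, a) ::ₘ Finsupp.toMultiset ν := by
            rw [map_add, Finsupp.toMultiset_single, one_smul, add_comm, Multiset.singleton_add]
          rw [monoMat_mul, hT, hT, hν]
          by_cases ha : a = .g
          · obtain ⟨r, rfl⟩ := hb.1 ha
            refine ⟨Submodule.subset_span ⟨_, _, ?_, rfl⟩, ?_⟩
            · rw [hν]
              exact hm.cons_scalar (t := (n, a)) ha r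
            · rw [map_smul, mul_smul_comm, mul_smul_comm, mul_one, map_smul, hSz _ _ (n, a) ha]
          · refine ⟨Submodule.subset_span ⟨_, _, ?_, rfl⟩, ?_⟩
            · rw [hν]
              exact hm.cons_traceless (t := (n, a)) ha (hb.2 ha)
            · have := hSw _ _ (n, a) b ha hm (hb.2 ha)
              simpa [w, ha] using this.symm
      exact hle (mem_span_letterU hk u)
  intro f hf
  have h1V : (monoMat 0 1 : Matrix (Fin k) (Fin k) (MvPolynomial (ℕ × BIdx k) F)) ∈ V :=
    Submodule.subset_span ⟨0, 1, ⟨fun _ => ⟨1, by simp⟩, fun h => by simp at h⟩, rfl⟩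
  have h := (hW f _ h1V).2
  have hT1 : T (monoMat 0 1) = 1 := by rw [hT, map_zero, hS1]
  have hG : Gl f = 0 := generic_eq_zero hf
  rw [hG, mul_zero, map_zero, hT1, one_mul] at h
  exact (hP f).1 h

omit [CharZero F] in
/-- Substituting `x_0^u ↦ x_n^{u c}` and `x_1^u ↦ x_m^{u d}` in an element of a `T_U`-ideal. -/
theorem subst_mem {I : Submodule F (FU F k)} (hI : IsTUIdeal I) (n m : ℕ) (c d : U F k) {f : FU F k}
    (hf : f ∈ I) :
    subst (F := F) (fun i => if i = 0 then n else m) (fun i => if i = 0 then c else d) f ∈ I :=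
  hI.endo_mem _ (isLEndo_subst _ _) f hf

theorem letterU_g_mul : exp_gg F hk * 1 = letterU hk .g 1 := by rw [mul_one, exp_gg_eq]

theorem exp_e12_e12_mul {a : BIdx k} (ha : a ≠ .g) :
    exp_e12_e12 F hk * letterU hk a (E F ⟨0, by omega⟩ ⟨1, by omega⟩)
      = letterU hk a (E F ⟨0, by omega⟩ ⟨1, by omega⟩) :=
  phiAB_mul_letterU hk _ _ _ ha

theorem exp_e12_e21_mul {a : BIdx k} (ha : a ≠ .g) :
    exp_e12_e21 F hk * letterU hk a (E F ⟨0, by omega⟩ ⟨1, by omega⟩)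
      = letterU hk a (E F ⟨1, by omega⟩ ⟨0, by omega⟩) :=
  phiAB_mul_letterU hk _ _ _ ha

theorem exp_e12_e31_mul (hk3 : 3 ≤ k) {a : BIdx k} (ha : a ≠ .g) :
    exp_e12_e31 F hk3 * letterU hk a (E F ⟨0, by omega⟩ ⟨1, by omega⟩)
      = letterU hk a (E F ⟨2, by omega⟩ ⟨0, by omega⟩) :=
  phiAB_mul_letterU hk _ _ _ ha

/-- Substituting letters `x_n^{a e_{12}}` for the variables spreads the generating identities to
all letters; the first one is left in the two forms that it takes for `k ≥ 3` and `k = 2`. -/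
theorem UIdentities_le_of_generators {I : Submodule F (FU F k)} (hI : IsTUIdeal I)
    (h1 : (∃ i j p : Fin k, i ≠ j ∧ i ≠ p ∧ j ≠ p ∧ ∀ n m a b, a ≠ .g → b ≠ .g →
        (xpow n (letterU hk a (E F i j)) * xpow m (letterU hk b (E F p i)) : FU F k) ∈ I) ∨
      ∃ i j : Fin k, i ≠ j ∧ (∀ p, p = i ∨ p = j) ∧ ∀ n m a b, a ≠ .g → b ≠ .g →
        (xpow n (letterU hk a (E F i j)) * xpow m (letterU hk b (E F i j)) : FU F k) ∈ I)
    (h2 : (xpow 0 (exp_e12_e12 F hk) * xpow 1 (exp_e12_e21 F hk)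
      - xpow 1 (exp_e12_e12 F hk) * xpow 0 (exp_e12_e21 F hk) : FU F k) ∈ I)
    (h3 : (xpow 0 (exp_gg F hk) * xpow 1 (exp_gg F hk)
      - xpow 1 (exp_gg F hk) * xpow 0 (exp_gg F hk) : FU F k) ∈ I)
    (h4 : (xpow 0 (exp_gg F hk) * xpow 1 (exp_e12_e12 F hk)
      - xpow 1 (exp_e12_e12 F hk) * xpow 0 (exp_gg F hk) : FU F k) ∈ I) :
    UIdentities F k ≤ I := by
  refine UIdentities_le hk hI h1 ⟨⟨0, by omega⟩, ⟨1, by omega⟩, by simp, fun n m a b ha hb => ?_⟩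
    (fun n m => ?_) ⟨⟨0, by omega⟩, ⟨1, by omega⟩, by simp, fun n m a ha => ?_⟩
  · have := subst_mem hI n m (letterU hk a (E F ⟨0, by omega⟩ ⟨1, by omega⟩))
      (letterU hk b (E F ⟨0, by omega⟩ ⟨1, by omega⟩)) h2
    simp only [map_sub, map_mul, subst_xpow, if_true, one_ne_zero, if_false] at this
    rwa [exp_e12_e12_mul hk ha, exp_e12_e21_mul hk ha, exp_e12_e12_mul hk hb,
      exp_e12_e21_mul hk hb] at this
  · have := subst_mem hI n m 1 1 h3
    simp only [map_sub, map_mul, subst_xpow, if_true, one_ne_zero, if_false] at this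
    rwa [letterU_g_mul] at this
  · have := subst_mem hI n m 1 (letterU hk a (E F ⟨0, by omega⟩ ⟨1, by omega⟩)) h4
    simp only [map_sub, map_mul, subst_xpow, if_true, one_ne_zero, if_false] at this
    rwa [exp_e12_e12_mul hk ha, letterU_g_mul] at this

omit [CharZero F] in
theorem TUspan_eq_UIdentities {S : Set (FU F k)} (hS : S ⊆ UIdentities F k)
    (h : ∀ I : Submodule F (FU F k), IsTUIdeal I → S ⊆ I → UIdentities F k ≤ I) :
    TUspan S = UIdentities F k :=
  le_antisymm ((TUspan_isLeast S).2 ⟨isTUIdeal_UIdentities, hS⟩)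
    (h _ (TUspan_isLeast S).1.1 (TUspan_isLeast S).1.2)

/-! ### The generating `U`-polynomials are identities -/

theorem gen_flip_mem : (xpow 0 (exp_e12_e12 F hk) * xpow 1 (exp_e12_e21 F hk)
    - xpow 1 (exp_e12_e12 F hk) * xpow 0 (exp_e12_e21 F hk) : FU F k) ∈ UIdentities F k := by
  intro a
  simp only [map_sub, map_mul, evalU_xpow, exp_e12_e12, exp_e12_e21, phiAB_apply,
    smul_mul_smul_comm]
  rw [mul_comm, sub_self]

theorem gen_gg_mem : (xpow 0 (exp_gg F hk) * xpow 1 (exp_gg F hk)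
    - xpow 1 (exp_gg F hk) * xpow 0 (exp_gg F hk) : FU F k) ∈ UIdentities F k := by
  intro a
  simp only [map_sub, map_mul, evalU_xpow, exp_gg, phiAB_apply, smul_mul_smul_comm]
  rw [mul_comm, sub_self]

theorem gen_central_mem : (xpow 0 (exp_gg F hk) * xpow 1 (exp_e12_e12 F hk)
    - xpow 1 (exp_e12_e12 F hk) * xpow 0 (exp_gg F hk) : FU F k) ∈ UIdentities F k := by
  intro a
  simp only [map_sub, map_mul, evalU_xpow, exp_gg, exp_e12_e12, phiAB_apply, smul_mul_smul_comm,
    bvec, one_mul, mul_one]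
  rw [mul_comm, sub_self]

theorem gen_square_mem :
    (xpow 0 (exp_e12_e12 F hk) * xpow 1 (exp_e12_e12 F hk) : FU F k) ∈ UIdentities F k := by
  intro a
  simp [map_mul, evalU_xpow, exp_e12_e12, phiAB_apply, e12, bvec]

theorem gen_e31_mem (hk3 : 3 ≤ k) :
    (xpow 0 (exp_e12_e12 F hk) * xpow 1 (exp_e12_e31 F hk3) : FU F k) ∈ UIdentities F k := by
  intro a
  simp [map_mul, evalU_xpow, exp_e12_e12, exp_e12_e31, phiAB_apply, e12, e31, bvec]

end Generation
end DiffMat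

open DiffMat
theorem mainTheorem4 (F : Type*) [Field F] [CharZero F] (k : ℕ) (hk : 2 ≤ k) :
    (k = 2 →
      TUspan
        {xpow 0 (exp_e12_e12 F hk) * xpow 1 (exp_e12_e12 F hk),
          xpow 0 (exp_e12_e12 F hk) * xpow 1 (exp_e12_e21 F hk)
            - xpow 1 (exp_e12_e12 F hk)
              * xpow 0 (exp_e12_e21 F hk),
          xpow 0 (exp_gg F hk) * xpow 1 (exp_gg F hk)
            - xpow 1 (exp_gg F hk) * xpow 0 (exp_gg F hk),
          xpow 0 (exp_gg F hk) * xpow 1 (exp_e12_e12 F hk)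
            - xpow 1 (exp_e12_e12 F hk) * xpow 0 (exp_gg F hk)}
        = UIdentities F k) ∧
    (∀ hk3 : 3 ≤ k,
      TUspan
        {xpow 0 (exp_e12_e12 F hk) * xpow 1 (exp_e12_e31 F hk3),
          xpow 0 (exp_e12_e12 F hk) * xpow 1 (exp_e12_e21 F hk)
            - xpow 1 (exp_e12_e12 F hk)
              * xpow 0 (exp_e12_e21 F hk),
          xpow 0 (exp_gg F hk) * xpow 1 (exp_gg F hk)
            - xpow 1 (exp_gg F hk) * xpow 0 (exp_gg F hk),
          xpow 0 (exp_gg F hk) * xpow 1 (exp_e12_e12 F hk)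
            - xpow 1 (exp_e12_e12 F hk) * xpow 0 (exp_gg F hk)}
        = UIdentities F k) := by
  refine ⟨fun h2 => TUspan_eq_UIdentities ?_ fun I hI hsub => ?_,
    fun hk3 => TUspan_eq_UIdentities ?_ fun I hI hsub => ?_⟩
  · rintro _ (rfl | rfl | rfl | rfl)
    exacts [gen_square_mem hk, gen_flip_mem hk, gen_gg_mem hk, gen_central_mem hk]
  · refine UIdentities_le_of_generators hk hI (.inr ⟨⟨0, by omega⟩, ⟨1, by omega⟩, by simp, ?_, ?_⟩)
      (hsub (.inr (.inl rfl))) (hsub (.inr (.inr (.inl rfl)))) (hsub (.inr (.inr (.inr rfl))))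
    · intro p
      simp only [Fin.ext_iff]
      omega
    · intro n m a b ha hb
      have := subst_mem hI n m (letterU hk a (E F ⟨0, by omega⟩ ⟨1, by omega⟩))
        (letterU hk b (E F ⟨0, by omega⟩ ⟨1, by omega⟩)) (hsub (.inl rfl))
      simp only [map_mul, subst_xpow, if_true, one_ne_zero, if_false] at this
      rwa [exp_e12_e12_mul hk ha, exp_e12_e12_mul hk hb] at this
  · rintro _ (rfl | rfl | rfl | rfl)
    exacts [gen_e31_mem hk hk3, gen_flip_mem hk, gen_gg_mem hk, gen_central_mem hk]
  · refine UIdentities_le_of_generators hk hI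
      (.inl ⟨⟨0, by omega⟩, ⟨1, by omega⟩, ⟨2, by omega⟩, by simp, by simp, by simp, ?_⟩)
      (hsub (.inr (.inl rfl))) (hsub (.inr (.inr (.inl rfl)))) (hsub (.inr (.inr (.inr rfl))))
    intro n m a b ha hb
    have := subst_mem hI n m (letterU hk a (E F ⟨0, by omega⟩ ⟨1, by omega⟩))
      (letterU hk b (E F ⟨0, by omega⟩ ⟨1, by omega⟩)) (hsub (.inl rfl))
    simp only [map_mul, subst_xpow, if_true, one_ne_zero, if_false] at this
    rwa [exp_e12_e12_mul hk ha, exp_e12_e31_mul hk hk3 hb] at this
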